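/- Let $F$ be a totally real number field of degree $d$ with ring of integers $\mathbb{Z}_F$, let $\sigma_1,\dots,\sigma_d$ be its embeddings into $\mathbb{R}$, and let $\mathfrak{p}_1,\dots,\mathfrak{p}_M$ be nonzero prime ideals of $\mathbb{Z}_F$ with absolute norms $N(\mathfrak{p}_k)$. An element $r$ of $\mathbb{Z}_F$ is totally positive if $\sigma_k(r)>0$ for all $k$. For every vector $R^{\min}\in(0,\infty)^d$ there exist real constants $C_{\min}<C_{\max}$ and a vector $R^{\max}$ with $R^{\min}_k\le R^{\max}_k$ for all $k$, such that for every integral basis of $\mathbb{Z}_F$ there exist an algorithm and a polynomial $P$ with the following property. For all non-negative integers $L_1,\dots,L_M$ and every real $\varepsilon\in(0,1)$ satisfying \[ L_1\log N(\mathfrak{p}_1)+\dots+L_M\log N(\mathfrak{p}_M)-4\log(1/\varepsilon)\in[C_{\min},C_{\max}], \] the algorithm, on input $(L_1,\dots,L_M)$ and $\varepsilon$, halts after at most $P(\log(1/\varepsilon))$ bit operations and decides whether the ideal $\mathfrak{p}_1^{L_1}\cdots\mathfrak{p}_M^{L_M}$ has a totally positive generator. If it has one, then the algorithm also outputs the coordinates,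 in the given integral basis, of a totally positive $r\in\mathbb{Z}_F$ such that $r\mathbb{Z}_F=\mathfrak{p}_1^{L_1}\cdots\mathfrak{p}_M^{L_M}$ and \[ \sqrt{\sigma_1(r)}\,\varepsilon^2/4\in[R^{\min}_1,R^{\max}_1],\qquad \sqrt{\sigma_k(r)}\in[R^{\min}_k,R^{\max}_k]\quad\text{for }k=2,\dots,d. \] Here the integers $L_k$ are given in binary, and the real number $\varepsilon$ is given by an oracle that, on request $n$, returns an integer $a_n$ with $|2^n\varepsilon-a_n|\le 1$ at a cost of at least $n$. Algorithms are deterministic programs over finitely many integer registers with assignments, sequencing, branching and while-loops, whose elementary operations (constants, addition, subtraction, multiplication, integer division, sign tests, oracle requests) are charged their bit cost. -/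

import Mathlib

open scoped NumberField

/-! ## Algorithms with bit cost

Algorithms are `while`-programs over finitely many integer registers.  Every elementary operation is
charged its bit cost (logarithmic cost criterion), so that, up to a polynomial, running time is the
same as running time on a multitape Turing machine.  A real number given as input is available through
approximations: asking for `n` binary digits costs at least `n`. -/

namespace BitMachine

/-- The contents of the registers. -/
abbrev State : Type := ℕ → ℤ

/-- The number of binary digits of an integer. -/
def bits (a : ℤ) : ℕ := Nat.size a.natAbs

/-- The right-hand sides of assignments; the arguments `y`, `z` are names of registers. -/
inductive Op : Type
  | const (c : ℤ) : Op
  | add (y z : ℕ) : Op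
  | sub (y z : ℕ) : Op
  | mul (y z : ℕ) : Op
  | div (y z : ℕ) : Op
  | query (y : ℕ) : Op

/-- The value of an operation in the state `s`, where `φ n` is the answer to the request for `n` binary
digits of the real input.  (`div` is Euclidean integer division, with value `0` for the divisor `0`.) -/
def Op.value (φ : ℕ → ℤ) (s : State) : Op → ℤ
  | .const c => c
  | .add y z => s y + s z
  | .sub y z => s y - s z
  | .mul y z => s y * s z
  | .div y z => s y / s z
  | .query y => φ (s y).toNat

/-- The bit cost of an operation in the state `s`. -/
def Op.cost (φ : ℕ → ℤ) (s : State) : Op → ℕ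
  | .const c => 1 + bits c
  | .add y z => 1 + bits (s y) + bits (s z)
  | .sub y z => 1 + bits (s y) + bits (s z)
  | .mul y z => (1 + bits (s y)) * (1 + bits (s z))
  | .div y z => (1 + bits (s y)) * (1 + bits (s z))
  | .query y => 1 + (s y).natAbs + bits (φ (s y).toNat)

/-- Programs. -/
inductive Prog : Type
  | skip : Prog
  | assign (x : ℕ) (e : Op) : Prog
  | seq (P Q : Prog) : Prog
  /-- Run `P` if register `x` is positive, and `Q` otherwise. -/
  | branch (x : ℕ) (P Q : Prog) : Prog
  /-- Run `P` again and again as long as register `x` is positive. -/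
  | loop (x : ℕ) (P : Prog) : Prog

/-- `Exec φ P s s' t`: started in the state `s`, the program `P` halts in the state `s'` after time
exactly `t`; the real input is accessed through `φ`. -/
inductive Exec (φ : ℕ → ℤ) : Prog → State → State → ℕ → Prop
  | skip (s : State) : Exec φ .skip s s 1
  | assign (x : ℕ) (e : Op) (s : State) :
      Exec φ (.assign x e) s (Function.update s x (e.value φ s)) (e.cost φ s)
  | seq {P Q : Prog} {s s' s'' : State} {t t' : ℕ} :
      Exec φ P s s' t → Exec φ Q s' s'' t' → Exec φ (.seq P Q) s s'' (t + t')
  | branch_pos {x : ℕ} {P Q : Prog} {s s' : State} {t : ℕ} :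
      0 < s x → Exec φ P s s' t → Exec φ (.branch x P Q) s s' (1 + bits (s x) + t)
  | branch_nonpos {x : ℕ} {P Q : Prog} {s s' : State} {t : ℕ} :
      s x ≤ 0 → Exec φ Q s s' t → Exec φ (.branch x P Q) s s' (1 + bits (s x) + t)
  | loop_pos {x : ℕ} {P : Prog} {s s' s'' : State} {t t' : ℕ} :
      0 < s x → Exec φ P s s' t → Exec φ (.loop x P) s' s'' t' →
        Exec φ (.loop x P) s s'' (1 + bits (s x) + t + t')
  | loop_nonpos {x : ℕ} {P : Prog} {s : State} :
      s x ≤ 0 → Exec φ (.loop x P) s s (1 + bits (s x))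

/-- `φ` represents the real number `a`: the answer `φ n` is an integer with
`|a - φ n / 2 ^ n| ≤ 2⁻ⁿ`. -/
def Represents (φ : ℕ → ℤ) (a : ℝ) : Prop :=
  ∀ n : ℕ, |(2 : ℝ) ^ n * a - (φ n : ℝ)| ≤ 1

/-- The initial state for the input `L`: registers `0, …, M - 1` hold `L`, all others hold `0`. -/
def inputState {M : ℕ} (L : Fin M → ℕ) : State :=
  fun i => if h : i < M then (L ⟨i, h⟩ : ℤ) else 0

end BitMachine

section Field

variable {F : Type*} [Field F] [NumberField F] {d : ℕ}

/-- `r` is positive under each of the embeddings `σ k`. -/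
def IsTotallyPositive (σ : Fin d ≃ (F →+* ℝ)) (r : 𝓞 F) : Prop :=
  ∀ k, 0 < σ k (r : F)

/-- `I = r 𝓞_F` for some totally positive `r`. -/
def HasTotallyPositiveGenerator (σ : Fin d ≃ (F →+* ℝ)) (I : Ideal (𝓞 F)) : Prop :=
  ∃ r : 𝓞 F, IsTotallyPositive σ r ∧ Ideal.span {r} = I

/-- The size windows, where `σ 0` is the distinguished embedding:
`√(σ₁ r) ε² / 4 ∈ [R₁ᵐⁱⁿ, R₁ᵐᵃˣ]`, and `√(σₖ r) ∈ [Rₖᵐⁱⁿ, Rₖᵐᵃˣ]` for the other embeddings. -/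
def InWindows [NeZero d] (σ : Fin d ≃ (F →+* ℝ)) (Rmin Rmax : Fin d → ℝ) (ε : ℝ) (r : 𝓞 F) :
    Prop :=
  √(σ 0 (r : F)) * ε ^ 2 / 4 ∈ Set.Icc (Rmin 0) (Rmax 0) ∧
    ∀ k, k ≠ 0 → √(σ k (r : F)) ∈ Set.Icc (Rmin k) (Rmax k)

/-- The algebraic integer whose coordinates in the integral basis `b` are held by the registers
`1, …, d`. -/
noncomputable def outputElement (b : Module.Basis (Fin d) ℤ (𝓞 F)) (s : BitMachine.State) : 𝓞 F :=
  ∑ i : Fin d, s ((i : ℕ) + 1) • b i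

end Field

/-! ### Bit lengths of integers. -/

namespace BitMachine

/-! Only the exponents have to be processed; `ε` enters through the norm alone. If `r` is a totally
positive generator, the product of all `σ k r` is the norm of the ideal, which is tied to `ε⁻⁴` up
to constant factors. So once the coordinates with `k ≠ 0` lie in fixed windows, `σ 0 r * ε ^ 4` does
too (`inWindows_of_bounds`).

Let `h` be twice the class number, so that every `p j ^ h` has a totally positive generator.
Dirichlet's unit theorem (`exists_unit_approx`) yields a finite set of such generators in which some
`g` always brings a bounded vector of coordinates `k ≠ 0` back into a fixed window
(`exists_candidates`). Starting from `r = 1`, as long as some exponent is at least `h`, `r` is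
multiplied by a suitable `g` and that exponent drops by `h`. What remains is one of finitely many
ideals, for which the answer and a generator `β` are hardwired into the program. Splitting off the
principal ideal of the totally positive `r` does not change the answer
(`hasTotallyPositiveGenerator_mul_iff`), and the output is `β * r`.

Real coordinates have to be compared by integer arithmetic. For each `k` there is a totally positive
`θ k` so dominant at `σ k` that the trace of `x * θ k ^ n`, divided by `σ k (θ k) ^ n`, exceeds `σ k
x` by at most `d`, provided that all `σ l x` are at most `H ^ n` (`trace_mul_pow_bounds`). Comparing
the trace of `r * g * θ k ^ n` with multiples of that of `θ k ^ n` therefore locates `σ k (r * g)`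
up to constants.

If `r`, the `r * θ k ^ t` and the `θ k ^ t` are carried along, a step is a linear map of a free
`ℤ`-module, selected by the signs of linear forms. It adds a bounded number of bits, so `N` steps
cost at most a cubic polynomial in `N` and the input size (`exists_prog_iterate_step`). Since prime
ideals have norm at least `2`, `N` is at most linear in `log (1 / ε)`. -/

theorem bits_le_iff {a : ℤ} {B : ℕ} : bits a ≤ B ↔ |a| < 2 ^ B := by
  rw [bits, Nat.size_le, ← Int.natCast_natAbs]
  exact_mod_cast Iff.rfl

theorem bits_add_le {a b : ℤ} {B : ℕ} (ha : bits a ≤ B) (hb : bits b ≤ B) :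
    bits (a + b) ≤ B + 1 := by
  rw [bits_le_iff] at *
  calc |a + b| ≤ |a| + |b| := abs_add_le a b
    _ < 2 ^ B + 2 ^ B := by gcongr
    _ = 2 ^ (B + 1) := by ring

theorem bits_mul_le {a b : ℤ} {B : ℕ} (ha : bits a ≤ B) (hb : bits b ≤ B) :
    bits (a * b) ≤ 2 * B := by
  rw [bits_le_iff] at *
  calc |a * b| = |a| * |b| := abs_mul a b
    _ < 2 ^ B * 2 ^ B := by gcongr
    _ = 2 ^ (2 * B) := by ring

@[simp] theorem bits_zero : bits 0 = 0 := by simp [bits]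

/-! ### Programs without loops, divisions and oracle requests -/

/-- Programs built from constants, additions, multiplications and branching. -/
def Prog.Straight : Prog → Prop
  | .skip => True
  | .assign _ (.const _) => True
  | .assign _ (.add _ _) => True
  | .assign _ (.mul _ _) => True
  | .assign _ _ => False
  | .seq P Q => P.Straight ∧ Q.Straight
  | .branch _ P Q => P.Straight ∧ Q.Straight
  | .loop _ _ => False

/-- The final state of a straight program. -/
def Prog.eval : Prog → State → State
  | .skip, s => s
  | .assign x e, s => Function.update s x (e.value 0 s)
  | .seq P Q, s => Q.eval (P.eval s)
  | .branch x P Q, s => if 0 < s x then P.eval s else Q.eval s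
  | .loop _ _, s => s

theorem bits_update_le {s : State} {x : ℕ} {a : ℤ} {B : ℕ} (hs : ∀ i, bits (s i) ≤ B)
    (ha : bits a ≤ B) (i : ℕ) : bits (Function.update s x a i) ≤ B := by
  rcases eq_or_ne i x with rfl | h
  · simpa using ha
  · simpa [h] using hs i

/-- A straight program runs in quadratic time, and the registers grow at most linearly. -/
theorem Prog.Straight.exec {P : Prog} (hP : P.Straight) :
    ∃ c : ℕ, ∀ (φ : ℕ → ℤ) (s : State) (B : ℕ), (∀ i, bits (s i) ≤ B) →
      (∃ t ≤ c * (B + 1) ^ 2, Exec φ P s (P.eval s) t) ∧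
        ∀ i, bits (P.eval s i) ≤ c * (B + 1) := by
  induction P with
  | skip =>
    refine ⟨1, fun φ s B hs => ⟨⟨1, ?_, .skip s⟩, fun i => (hs i).trans (by omega)⟩⟩
    nlinarith [Nat.zero_le B]
  | assign x e =>
    cases e with
    | const a =>
      refine ⟨1 + bits a, fun φ s B hs => ⟨⟨_, ?_, .assign x _ s⟩, ?_⟩⟩
      · exact Nat.le_mul_of_pos_right _ (by positivity)
      · exact bits_update_le (fun i => (hs i).trans (by nlinarith [Nat.zero_le (bits a)]))
          (show bits a ≤ _ by nlinarith [Nat.zero_le (bits a * B)])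
    | add y z =>
      refine ⟨2, fun φ s B hs => ⟨⟨_, ?_, .assign x _ s⟩, ?_⟩⟩
      · have hy := hs y
        have hz := hs z
        simp only [Op.cost]
        nlinarith
      · exact bits_update_le (fun i => (hs i).trans (by omega))
          ((bits_add_le (hs y) (hs z)).trans (by omega))
    | mul y z =>
      refine ⟨2, fun φ s B hs => ⟨⟨_, ?_, .assign x _ s⟩, ?_⟩⟩
      · have hy := hs y
        have hz := hs z
        calc (1 + bits (s y)) * (1 + bits (s z)) ≤ (B + 1) * (B + 1) := by exact Nat.mul_le_mul (by omega) (by omega)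
          _ ≤ 2 * (B + 1) ^ 2 := by nlinarith
      · exact bits_update_le (fun i => (hs i).trans (by omega))
          ((bits_mul_le (hs y) (hs z)).trans (by omega))
    | sub y z => exact hP.elim
    | div y z => exact hP.elim
    | query y => exact hP.elim
  | seq P Q ihP ihQ =>
    obtain ⟨c₁, h₁⟩ := ihP hP.1
    obtain ⟨c₂, h₂⟩ := ihQ hP.2
    -- The second program starts from registers of size up to `c₁ * (B + 1)`, which enters its
    -- running time squared.
    refine ⟨c₁ + c₂ * (c₁ + 1) ^ 2, fun φ s B hs => ?_⟩
    obtain ⟨⟨t₁, ht₁, e₁⟩, b₁⟩ := h₁ φ s B hs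
    obtain ⟨⟨t₂, ht₂, e₂⟩, b₂⟩ := h₂ φ _ _ b₁
    have hle : c₁ * (B + 1) + 1 ≤ (c₁ + 1) * (B + 1) := by nlinarith
    refine ⟨⟨t₁ + t₂, ?_, .seq e₁ e₂⟩, fun i => (b₂ i).trans ?_⟩
    · calc t₁ + t₂ ≤ c₁ * (B + 1) ^ 2 + c₂ * ((c₁ + 1) * (B + 1)) ^ 2 := by
            refine add_le_add ht₁ (ht₂.trans ?_); gcongr
        _ = _ := by ring
    · calc c₂ * (c₁ * (B + 1) + 1) ≤ c₂ * ((c₁ + 1) * (B + 1)) := by gcongr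
        _ = c₂ * (c₁ + 1) * 1 * (B + 1) := by ring
        _ ≤ c₂ * (c₁ + 1) * (c₁ + 1) * (B + 1) := by gcongr; omega
        _ ≤ _ := by nlinarith [Nat.zero_le (c₁ * (B + 1))]
  | branch x P Q ihP ihQ =>
    obtain ⟨c₁, h₁⟩ := ihP hP.1
    obtain ⟨c₂, h₂⟩ := ihQ hP.2
    refine ⟨1 + c₁ + c₂, fun φ s B hs => ?_⟩
    obtain ⟨⟨t₁, ht₁, e₁⟩, b₁⟩ := h₁ φ s B hs
    obtain ⟨⟨t₂, ht₂, e₂⟩, b₂⟩ := h₂ φ s B hs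
    have hx := hs x
    have hB : B + 1 ≤ (B + 1) ^ 2 := Nat.le_self_pow (by norm_num) _
    by_cases h : 0 < s x
    · simp only [Prog.eval, h, if_true]
      refine ⟨⟨_, ?_, .branch_pos h e₁⟩, fun i => (b₁ i).trans ?_⟩
      · nlinarith [Nat.zero_le (c₂ * (B + 1) ^ 2)]
      · gcongr; omega
    · simp only [Prog.eval, h, if_false]
      refine ⟨⟨_, ?_, .branch_nonpos (not_lt.mp h) e₂⟩, fun i => (b₂ i).trans ?_⟩
      · nlinarith [Nat.zero_le (c₁ * (B + 1) ^ 2)]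
      · gcongr; omega
  | loop x P _ => exact hP.elim

/-- Programs run one after another. -/
def Prog.seqs : List Prog → Prog
  | [] => .skip
  | P :: l => .seq P (Prog.seqs l)

theorem Prog.straight_seqs {l : List Prog} (h : ∀ P ∈ l, P.Straight) : (Prog.seqs l).Straight := by
  induction l with
  | nil => trivial
  | cons P l ih => exact ⟨h P (by simp), ih fun Q hQ => h Q (by simp [hQ])⟩

/-- Register `x` receives a linear combination; register `y` is used as temporary storage. -/
def linProg (y x : ℕ) : List (ℤ × ℕ) → Prog
  | [] => .assign x (.const 0)
  | (c, i) :: l =>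
    .seq (linProg y x l)
      (.seq (.assign y (.const c)) (.seq (.assign y (.mul y i)) (.assign x (.add x y))))

theorem straight_linProg (y x : ℕ) (l : List (ℤ × ℕ)) : (linProg y x l).Straight := by
  induction l with
  | nil => trivial
  | cons a l ih => exact ⟨ih, trivial, trivial, trivial⟩

theorem eval_linProg {y x : ℕ} (hxy : x ≠ y) (l : List (ℤ × ℕ)) (hl : ∀ a ∈ l, a.2 ≠ x ∧ a.2 ≠ y)
    (s : State) :
    (linProg y x l).eval s x = (l.map fun a => a.1 * s a.2).sum ∧
      ∀ i, i ≠ x → i ≠ y → (linProg y x l).eval s i = s i := by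
  induction l with
  | nil =>
    refine ⟨by simp [linProg, Prog.eval, Op.value], fun i hx hy => ?_⟩
    simp [linProg, Prog.eval, hx]
  | cons a l ih =>
    obtain ⟨h₁, h₂⟩ := ih fun b hb => hl b (by simp [hb])
    obtain ⟨hax, hay⟩ := hl a (by simp)
    refine ⟨?_, fun i hx hy => ?_⟩
    · simp [linProg, Prog.eval, Op.value, hxy, h₁, h₂ _ hax hay, hay, add_comm]
    · simp [linProg, Prog.eval, hx, hy, h₂ i hx hy]

/-! ### Piecewise linear maps -/

section Step

variable {V : Type*} [AddCommGroup V]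

/-- The first linear map on the list whose conditions (positivity of linear forms) all hold
is applied. -/
def step : List (List (V →ₗ[ℤ] ℤ) × (V →ₗ[ℤ] V)) → V → V
  | [], v => v
  | o :: l, v => if ∀ ℓ ∈ o.1, 0 < ℓ v then o.2 v else step l v

/-- The option lists used later come from `Finset.toList`, so their order is arbitrary; all that
matters is that the option which fires passes its own tests. The list `l'` holds a fallback. -/
theorem step_of_exists {l : List (List (V →ₗ[ℤ] ℤ) × (V →ₗ[ℤ] V))} {v : V}
    (h : ∃ o ∈ l, ∀ ℓ ∈ o.1, 0 < ℓ v) (l' : List (List (V →ₗ[ℤ] ℤ) × (V →ₗ[ℤ] V))) :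
    ∃ o ∈ l, (∀ ℓ ∈ o.1, 0 < ℓ v) ∧ step (l ++ l') v = o.2 v := by
  induction l with
  | nil => simp at h
  | cons o l ih =>
    by_cases ho : ∀ ℓ ∈ o.1, 0 < ℓ v
    · exact ⟨o, by simp, ho, by simp only [List.cons_append, step, if_pos ho]⟩
    · obtain ⟨o', ho', hp⟩ := h
      rcases List.mem_cons.mp ho' with rfl | hm
      · exact absurd hp ho
      · obtain ⟨o'', h₁, h₂, h₃⟩ := ih ⟨o', hm, hp⟩
        exact ⟨o'', by simp [h₁], h₂, by simp only [List.cons_append, step, if_neg ho, h₃]⟩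

theorem step_of_forall_not {l : List (List (V →ₗ[ℤ] ℤ) × (V →ₗ[ℤ] V))} {v : V}
    (h : ∀ o ∈ l, ¬ ∀ ℓ ∈ o.1, 0 < ℓ v) (l' : List (List (V →ₗ[ℤ] ℤ) × (V →ₗ[ℤ] V))) :
    step (l ++ l') v = step l' v := by
  induction l with
  | nil => rfl
  | cons o l ih =>
    simp only [List.cons_append, step, if_neg (h o (by simp))]
    exact ih fun o' ho' => h o' (by simp [ho'])

/-- Transport of a list of conditional linear maps along a linear equivalence. -/
def conjOptions {V' : Type*} [AddCommGroup V'] (e : V' ≃ₗ[ℤ] V)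
    (l : List (List (V →ₗ[ℤ] ℤ) × (V →ₗ[ℤ] V))) : List (List (V' →ₗ[ℤ] ℤ) × (V' →ₗ[ℤ] V')) :=
  l.map fun o => (o.1.map fun ℓ => ℓ ∘ₗ e.toLinearMap,
    e.symm.toLinearMap ∘ₗ o.2 ∘ₗ e.toLinearMap)

/-- This allows the reduction to be described on a module of algebraic integers and run on integer
vectors. -/
theorem step_conjOptions {V' : Type*} [AddCommGroup V'] (e : V' ≃ₗ[ℤ] V)
    (l : List (List (V →ₗ[ℤ] ℤ) × (V →ₗ[ℤ] V))) (v : V) :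
    step (conjOptions e l) (e.symm v) = e.symm (step l v) := by
  induction l with
  | nil => rfl
  | cons o l ih =>
    simp only [conjOptions, List.map_cons, step] at ih ⊢
    by_cases ho : ∀ ℓ ∈ o.1, 0 < ℓ v
    · rw [if_pos ho, if_pos (by simpa using ho)]; simp
    · rw [if_neg ho, if_neg (by simpa using ho), ih]

end Step

/-! ### Register programs for piecewise linear maps. -/

section Machine

variable {n : ℕ}

/-- The state with the vector `v` in the first `n` registers and `0` in the others. -/
def encode (v : Fin n → ℤ) : State := fun i => if h : i < n then v ⟨i, h⟩ else 0

/-- The first `n` registers hold `v`, and only the first `2 n + 2` registers are in use. -/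
def Holds (s : State) (v : Fin n → ℤ) : Prop :=
  (∀ i : Fin n, s i = v i) ∧ ∀ i, 2 * n + 2 ≤ i → s i = 0

theorem holds_encode (v : Fin n → ℤ) : Holds (encode v) v :=
  ⟨fun i => by simp [encode], fun i hi => by simp [encode, show ¬ i < n by omega]⟩

/-- Evaluation of a linear form of the first `n` registers. -/
def formProg (x : ℕ) (ℓ : (Fin n → ℤ) →ₗ[ℤ] ℤ) : Prog :=
  linProg (2 * n) x (List.ofFn fun i : Fin n => (ℓ (Pi.single i 1), (i : ℕ)))

theorem straight_formProg (x : ℕ) (ℓ : (Fin n → ℤ) →ₗ[ℤ] ℤ) : (formProg x ℓ).Straight :=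
  straight_linProg _ _ _

theorem eval_formProg {x : ℕ} (hx : n ≤ x) (hx' : x ≠ 2 * n) (ℓ : (Fin n → ℤ) →ₗ[ℤ] ℤ)
    {s : State} {v : Fin n → ℤ} (hs : ∀ i : Fin n, s i = v i) :
    (formProg x ℓ).eval s x = ℓ v ∧
      ∀ i, i ≠ x → i ≠ 2 * n → (formProg x ℓ).eval s i = s i := by
  have hl : ∀ a ∈ List.ofFn fun i : Fin n => (ℓ (Pi.single i 1), (i : ℕ)),
      a.2 ≠ x ∧ a.2 ≠ 2 * n := by
    intro a ha
    obtain ⟨i, rfl⟩ := (List.mem_ofFn' _ _).mp ha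
    have := i.2
    constructor <;> dsimp only <;> omega
  obtain ⟨h₁, h₂⟩ := eval_linProg hx' _ hl s
  refine ⟨?_, h₂⟩
  rw [formProg, h₁, List.map_ofFn, List.sum_ofFn]
  have hv : v = ∑ i, v i • (Pi.single i 1 : Fin n → ℤ) := by
    ext j; simp [Finset.sum_apply, Pi.single_apply]
  conv_rhs => rw [hv, map_sum]
  refine Finset.sum_congr rfl fun i _ => ?_
  rw [map_zsmul, smul_eq_mul, mul_comm, ← hs i]
  rfl

/-- Application of a linear map to the vector in the first `n` registers. -/
def mapProg (A : (Fin n → ℤ) →ₗ[ℤ] (Fin n → ℤ)) : Prog :=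
  .seq (.seqs ((List.finRange n).map fun i : Fin n => formProg (n + i) (LinearMap.proj i ∘ₗ A)))
    (.seqs ((List.finRange n).map fun i : Fin n => linProg (2 * n) i [(1, n + i)]))

theorem straight_mapProg (A : (Fin n → ℤ) →ₗ[ℤ] (Fin n → ℤ)) : (mapProg A).Straight := by
  refine ⟨Prog.straight_seqs fun P hP => ?_, Prog.straight_seqs fun P hP => ?_⟩
  all_goals
    obtain ⟨i, -, rfl⟩ := List.mem_map.mp hP
    exact straight_linProg _ _ _

/-- The new coordinates go to the registers `n, …, 2 n - 1`, so that each form still reads the old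
vector; `eval_copies` then moves them down. `Nodup` ensures that no result is overwritten later. -/
theorem eval_forms (A : (Fin n → ℤ) →ₗ[ℤ] (Fin n → ℤ)) (l : List (Fin n)) (hl : l.Nodup)
    {s : State} {v : Fin n → ℤ} (hs : ∀ i : Fin n, s i = v i) :
    (∀ i ∈ l, (Prog.seqs (l.map fun i : Fin n => formProg (n + i) (LinearMap.proj i ∘ₗ A))).eval s (n + i)
      = A v i) ∧
    ∀ i : ℕ, i ≠ 2 * n → (∀ j ∈ l, i ≠ n + j) →
      (Prog.seqs (l.map fun i : Fin n => formProg (n + i) (LinearMap.proj i ∘ₗ A))).eval s i = s i := by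
  induction l generalizing s with
  | nil => simp [Prog.seqs, Prog.eval]
  | cons a l ih =>
    have ha := a.2
    obtain ⟨h₁, h₂⟩ := eval_formProg (x := n + a) (by omega) (by omega) (LinearMap.proj a ∘ₗ A) hs
    rw [List.nodup_cons] at hl
    obtain ⟨h₃, h₄⟩ := ih hl.2 (s := (formProg (n + a) (LinearMap.proj a ∘ₗ A)).eval s)
      fun i => by have := i.2; rw [h₂ _ (by omega) (by omega), hs]
    simp only [List.map_cons, Prog.seqs, Prog.eval]
    refine ⟨fun i hi => ?_, fun i hi hi' => ?_⟩
    · rcases List.mem_cons.mp hi with rfl | hi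
      · rw [h₄ _ (by omega), h₁]
        · rfl
        · intro j hj hij
          have : i = j := Fin.ext (by omega)
          exact hl.1 (this ▸ hj)
      · exact h₃ i hi
    · rw [h₄ i hi fun j hj => hi' j (by simp [hj]), h₂ i (hi' a (by simp)) hi]

theorem eval_copies (l : List (Fin n)) (hl : l.Nodup) (s : State) :
    (∀ i ∈ l, (Prog.seqs (l.map fun i : Fin n => linProg (2 * n) i [(1, n + i)])).eval s i
      = s (n + i)) ∧
    ∀ i : ℕ, i ≠ 2 * n → (∀ j ∈ l, i ≠ j) →
      (Prog.seqs (l.map fun i : Fin n => linProg (2 * n) i [(1, n + i)])).eval s i = s i := by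
  induction l generalizing s with
  | nil => simp [Prog.seqs, Prog.eval]
  | cons a l ih =>
    have ha := a.2
    obtain ⟨h₁, h₂⟩ := eval_linProg (x := a) (y := 2 * n) (by omega) [(1, n + (a : ℕ))]
      (by simp; omega) s
    rw [List.nodup_cons] at hl
    obtain ⟨h₃, h₄⟩ := ih hl.2 ((linProg (2 * n) a [(1, n + (a : ℕ))]).eval s)
    simp only [List.map_cons, Prog.seqs, Prog.eval]
    refine ⟨fun i hi => ?_, fun i hi hi' => ?_⟩
    · rcases List.mem_cons.mp hi with rfl | hi
      · rw [h₄ _ (by omega), h₁]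
        · simp
        · intro j hj hij
          have : i = j := Fin.ext (by omega)
          exact hl.1 (this ▸ hj)
      · have := i.2
        rw [h₃ i hi, h₂ _ (by omega) (by omega)]
    · rw [h₄ i hi fun j hj => hi' j (by simp [hj]), h₂ i (hi' a (by simp)) hi]

theorem Holds.mapProg (A : (Fin n → ℤ) →ₗ[ℤ] (Fin n → ℤ)) {s : State} {v : Fin n → ℤ}
    (hs : Holds s v) : Holds ((mapProg A).eval s) (A v) := by
  obtain ⟨h₁, h₂⟩ := eval_forms A (List.finRange n) (List.nodup_finRange n) hs.1
  obtain ⟨h₃, h₄⟩ := eval_copies (List.finRange n) (List.nodup_finRange n)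
    ((Prog.seqs ((List.finRange n).map fun i : Fin n => formProg (n + i) (LinearMap.proj i ∘ₗ A))).eval s)
  refine ⟨fun i => ?_, fun i hi => ?_⟩
  · rw [BitMachine.mapProg, Prog.eval, h₃ i (List.mem_finRange i), h₁ i (List.mem_finRange i)]
  · rw [BitMachine.mapProg, Prog.eval, h₄ i (by omega), h₂ i (by omega), hs.2 i hi]
    · intro j _; have := j.2; omega
    · intro j _; have := j.2; omega

/-- Run `P` if all the linear forms on the list are positive, and `Q` otherwise. -/
def testProg (P Q : Prog) : List ((Fin n → ℤ) →ₗ[ℤ] ℤ) → Prog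
  | [] => P
  | ℓ :: l => .seq (formProg (2 * n + 1) ℓ) (.branch (2 * n + 1) (testProg P Q l) Q)

theorem straight_testProg {P Q : Prog} (hP : P.Straight) (hQ : Q.Straight)
    (l : List ((Fin n → ℤ) →ₗ[ℤ] ℤ)) : (testProg P Q l).Straight := by
  induction l with
  | nil => exact hP
  | cons ℓ l ih => exact ⟨straight_formProg _ _, ih, hQ⟩

theorem Holds.testProg {P Q : Prog} {v w w' : Fin n → ℤ}
    (hP : ∀ s, Holds s v → Holds (P.eval s) w) (hQ : ∀ s, Holds s v → Holds (Q.eval s) w')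
    (l : List ((Fin n → ℤ) →ₗ[ℤ] ℤ)) {s : State} (hs : Holds s v) :
    Holds ((testProg P Q l).eval s) (if ∀ ℓ ∈ l, 0 < ℓ v then w else w') := by
  induction l generalizing s with
  | nil => simpa [BitMachine.testProg] using hP s hs
  | cons ℓ l ih =>
    obtain ⟨h₁, h₂⟩ := eval_formProg (x := 2 * n + 1) (by omega) (by omega) ℓ hs.1
    have hs' : Holds ((formProg (2 * n + 1) ℓ).eval s) v :=
      ⟨fun i => by have := i.2; rw [h₂ _ (by omega) (by omega), hs.1],
        fun i hi => by rw [h₂ _ (by omega) (by omega), hs.2 i hi]⟩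
    simp only [BitMachine.testProg, Prog.eval, h₁, List.mem_cons, forall_eq_or_imp]
    by_cases h : 0 < ℓ v
    · simpa only [h, if_true, true_and] using ih hs'
    · simpa only [h, if_false, false_and] using hQ _ hs'

/-- The program for `step`. -/
def stepProg : List (List ((Fin n → ℤ) →ₗ[ℤ] ℤ) × ((Fin n → ℤ) →ₗ[ℤ] (Fin n → ℤ))) → Prog
  | [] => .skip
  | o :: l => testProg (mapProg o.2) (stepProg l) o.1

theorem straight_stepProg
    (l : List (List ((Fin n → ℤ) →ₗ[ℤ] ℤ) × ((Fin n → ℤ) →ₗ[ℤ] (Fin n → ℤ)))) :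
    (stepProg l).Straight := by
  induction l with
  | nil => trivial
  | cons o l ih => exact straight_testProg (straight_mapProg _) ih _

theorem Holds.stepProg
    (l : List (List ((Fin n → ℤ) →ₗ[ℤ] ℤ) × ((Fin n → ℤ) →ₗ[ℤ] (Fin n → ℤ))))
    {s : State} {v : Fin n → ℤ} (hs : Holds s v) : Holds ((stepProg l).eval s) (step l v) := by
  induction l generalizing s with
  | nil => exact hs
  | cons o l ih => exact Holds.testProg (fun s hs => hs.mapProg o.2) (fun s hs => ih hs) o.1 hs

/-- Constants are stored in registers. -/
def constProg (l : List (ℕ × ℤ)) : Prog :=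
  .seqs (l.map fun a => .assign a.1 (.const a.2))

theorem straight_constProg (l : List (ℕ × ℤ)) : (constProg l).Straight := by
  refine Prog.straight_seqs fun P hP => ?_
  obtain ⟨i, -, rfl⟩ := List.mem_map.mp hP
  trivial

theorem eval_constProg (l : List (ℕ × ℤ)) (c : ℕ → ℤ) (hl : ∀ a ∈ l, a.2 = c a.1) (s : State)
    (i : ℕ) : (constProg l).eval s i = if i ∈ l.map Prod.fst then c i else s i := by
  induction l generalizing s with
  | nil => simp [constProg, Prog.seqs, Prog.eval]
  | cons a l ih =>
    have h := ih (fun b hb => hl b (by simp [hb])) (Function.update s a.1 a.2)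
    simp only [constProg, List.map_cons, Prog.seqs, Prog.eval, Op.value] at h ⊢
    rw [h]
    by_cases h₁ : i ∈ l.map Prod.fst
    · simp [h₁]
    · by_cases h₂ : i = a.1
      · subst h₂; simp [hl a]
      · simp [h₁, h₂]

/-- The temporary registers are set to `0`. -/
def clearProg (n : ℕ) : Prog := constProg ((List.range (n + 2)).map fun i => (n + i, 0))

/-- After clearing, the whole state is a function of the vector, so that successive passes of a loop
compose as iterates of one map. -/
theorem Holds.clearProg {s : State} {v : Fin n → ℤ} (hs : Holds s v) :
    (clearProg n).eval s = encode v := by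
  ext i
  rw [BitMachine.clearProg, eval_constProg _ 0 (by simp)]
  rcases lt_or_ge i n with h | h
  · rw [if_neg (by simp; omega)]
    simpa [encode, h] using hs.1 ⟨i, h⟩
  · rw [encode, dif_neg (by omega)]
    split_ifs with h'
    · rfl
    · refine hs.2 i ?_
      by_contra hlt
      exact h' (by simp only [List.map_map, List.mem_map, List.mem_range]
                   exact ⟨i - n, by omega, by simp; omega⟩)

/-- The program for `step`, followed by the deletion of temporary data. -/
def cleanStepProg (l : List (List ((Fin n → ℤ) →ₗ[ℤ] ℤ) × ((Fin n → ℤ) →ₗ[ℤ] (Fin n → ℤ)))) :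
    Prog := .seq (stepProg l) (clearProg n)

theorem straight_cleanStepProg
    (l : List (List ((Fin n → ℤ) →ₗ[ℤ] ℤ) × ((Fin n → ℤ) →ₗ[ℤ] (Fin n → ℤ)))) :
    (cleanStepProg l).Straight := ⟨straight_stepProg l, straight_constProg _⟩

theorem eval_cleanStepProg
    (l : List (List ((Fin n → ℤ) →ₗ[ℤ] ℤ) × ((Fin n → ℤ) →ₗ[ℤ] (Fin n → ℤ)))) (v : Fin n → ℤ) :
    (cleanStepProg l).eval (encode v) = encode (step l v) :=
  ((holds_encode v).stepProg l).clearProg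

theorem bits_encode_le {v : Fin n → ℤ} {B : ℕ} (hv : ∀ i, bits (v i) ≤ B) (i : ℕ) :
    bits (encode v i) ≤ B := by
  unfold encode
  split_ifs with h
  · exact hv _
  · simp

/-- Linear maps on a finite list increase the bit sizes by at most a constant. -/
theorem exists_bits_step_le
    (l : List (List ((Fin n → ℤ) →ₗ[ℤ] ℤ) × ((Fin n → ℤ) →ₗ[ℤ] (Fin n → ℤ)))) :
    ∃ κ : ℕ, ∀ (v : Fin n → ℤ) (B : ℕ), (∀ i, bits (v i) ≤ B) → ∀ i, bits (step l v i) ≤ B + κ := by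
  induction l with
  | nil => exact ⟨0, fun v B h => h⟩
  | cons o l ih =>
    obtain ⟨κ, hκ⟩ := ih
    set C : ℤ := ∑ i, ∑ j, |o.2 (Pi.single j 1) i| with hC
    have hC0 : 0 ≤ C := by positivity
    refine ⟨κ + bits C, fun v B hv i => ?_⟩
    simp only [step]
    split_ifs with h
    · suffices bits (o.2 v i) ≤ B + bits C by omega
      rw [bits_le_iff]
      have hCb : C < 2 ^ bits C := by
        have := bits_le_iff.mp (le_refl (bits C))
        rwa [abs_of_nonneg hC0] at this
      have hexp : v = ∑ j, v j • (Pi.single j 1 : Fin n → ℤ) := by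
        ext j; simp [Finset.sum_apply, Pi.single_apply]
      have : o.2 v i = ∑ j, v j * o.2 (Pi.single j 1) i := by
        conv_lhs => rw [hexp, map_sum]
        simp only [Finset.sum_apply, map_zsmul, Pi.smul_apply, smul_eq_mul]
      calc |o.2 v i| ≤ ∑ j, |v j * o.2 (Pi.single j 1) i| := by
            rw [this]; exact Finset.abs_sum_le_sum_abs _ _
        _ ≤ ∑ j, 2 ^ B * |o.2 (Pi.single j 1) i| := by
            refine Finset.sum_le_sum fun j _ => ?_
            rw [abs_mul]
            have := (bits_le_iff.mp (hv j)).le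
            gcongr
        _ = 2 ^ B * ∑ j, |o.2 (Pi.single j 1) i| := by rw [Finset.mul_sum]
        _ ≤ 2 ^ B * C := by
            gcongr
            exact Finset.single_le_sum (f := fun i => ∑ j, |o.2 (Pi.single j 1) i|)
              (fun i _ => by positivity) (Finset.mem_univ i)
        _ < 2 ^ B * 2 ^ bits C := by gcongr
        _ = 2 ^ (B + bits C) := by rw [pow_add]
    · exact (hκ v B hv i).trans (by omega)

/-- The gain per step is additive, so sizes stay linear in `N`. Iterating the multiplicative bound
of `Prog.Straight.exec` would only give an exponential estimate. -/
theorem bits_iterate_step_le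
    {l : List (List ((Fin n → ℤ) →ₗ[ℤ] ℤ) × ((Fin n → ℤ) →ₗ[ℤ] (Fin n → ℤ)))} {κ : ℕ}
    (hκ : ∀ (v : Fin n → ℤ) (B : ℕ), (∀ i, bits (v i) ≤ B) → ∀ i, bits (step l v i) ≤ B + κ)
    {v : Fin n → ℤ} {B : ℕ} (hv : ∀ i, bits (v i) ≤ B) (N : ℕ) (i : Fin n) :
    bits ((step l)^[N] v i) ≤ B + N * κ := by
  induction N generalizing i with
  | zero => simpa using hv i
  | succ N ih =>
    rw [Function.iterate_succ_apply']
    refine (hκ _ _ ih i).trans (by rw [add_mul]; omega)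

/-- The size bound `B` is required along the whole orbit, so that a single `T` serves all passes.
The factor `N + 1` includes the final test, which fails. -/
theorem exec_loop {φ : ℕ → ℤ} {P : Prog} {g : (Fin n → ℤ) → (Fin n → ℤ)} {B T : ℕ} (f : Fin n)
    (hP : ∀ v : Fin n → ℤ, (∀ i, bits (v i) ≤ B) →
      ∃ t ≤ T, Exec φ P (encode v) (encode (g v)) t)
    (N : ℕ) (v : Fin n → ℤ) (hB : ∀ k ≤ N, ∀ i, bits (g^[k] v i) ≤ B)
    (hpos : ∀ k < N, 0 < g^[k] v f) (hN : g^[N] v f ≤ 0) :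
    ∃ t ≤ (N + 1) * (1 + B + T), Exec φ (.loop f P) (encode v) (encode (g^[N] v)) t := by
  have hf : encode v f = v f := by simp [encode]
  have hb : bits (encode v f) ≤ B := by rw [hf]; exact hB 0 (by omega) f
  induction N generalizing v with
  | zero =>
    refine ⟨_, ?_, .loop_nonpos (by rw [hf]; simpa using hN)⟩
    omega
  | succ N ih =>
    obtain ⟨t, ht, h⟩ := hP v (hB 0 (by omega))
    have hf' : encode (g v) f = g v f := by simp [encode]
    obtain ⟨t', ht', h'⟩ := ih (g v) (fun k hk => hB (k + 1) (by omega))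
      (fun k hk => hpos (k + 1) (by omega)) hN hf' (by rw [hf']; exact hB 1 (by omega) f)
    refine ⟨_, ?_, .loop_pos (by rw [hf]; exact hpos 0 (by omega)) h h'⟩
    have : (N + 1 + 1) * (1 + B + T) = (N + 1) * (1 + B + T) + (1 + B + T) := by ring
    omega

/-- Iterated conditional linear maps are computed in time cubic in the number of iterations and
the size of the input. -/
theorem exists_prog_iterate_step {M : ℕ} (hM : M ≤ n) (init : Fin n → ℤ) (f : Fin n)
    (l₁ l₂ : List (List ((Fin n → ℤ) →ₗ[ℤ] ℤ) × ((Fin n → ℤ) →ₗ[ℤ] (Fin n → ℤ)))) :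
    ∃ (P : Prog) (c : ℕ), ∀ (φ : ℕ → ℤ) (L : Fin M → ℕ) (v : Fin n → ℤ) (N B : ℕ),
      (∀ i : Fin n, v i = if h : (i : ℕ) < M then (L ⟨i, h⟩ : ℤ) else init i) →
      (∀ j, bits (L j) ≤ B) →
      (∀ k < N, 0 < (step l₁)^[k] v f) → (step l₁)^[N] v f ≤ 0 →
      ∃ t ≤ c * (N + B + 1) ^ 3,
        Exec φ P (inputState L) (encode (step l₂ ((step l₁)^[N] v))) t := by
  -- Constants are written only from register `M` on, because the registers below hold the input.
  set cl : List (ℕ × ℤ) :=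
    ((List.finRange n).filter fun i : Fin n => M ≤ (i : ℕ)).map fun i : Fin n => ((i : ℕ), init i) with hcl
  obtain ⟨c₀, h₀⟩ := (straight_constProg cl).exec
  obtain ⟨c₁, h₁⟩ := (straight_cleanStepProg l₁).exec
  obtain ⟨c₂, h₂⟩ := (straight_cleanStepProg l₂).exec
  obtain ⟨κ, hκ⟩ := exists_bits_step_le l₁
  set b₀ := ∑ i, bits (init i) with hb₀
  set D := 1 + b₀ + κ with hD
  refine ⟨.seq (constProg cl) (.seq (.loop f (cleanStepProg l₁)) (cleanStepProg l₂)),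
    c₀ + (1 + c₁) * D ^ 2 + c₂ * D ^ 2, fun φ L v N B hv hB hpos hN => ?_⟩
  have hinit : (constProg cl).eval (inputState L) = encode v := by
    ext i
    rw [eval_constProg cl (fun i => if h : i < n then init ⟨i, h⟩ else 0)]
    · have hmem : i ∈ cl.map Prod.fst ↔ M ≤ i ∧ i < n := by
        simp only [hcl, List.map_map, List.mem_map, List.mem_filter, List.mem_finRange, true_and,
          Function.comp, decide_eq_true_eq]
        exact ⟨by rintro ⟨a, ha, rfl⟩; exact ⟨ha, a.2⟩, fun h => ⟨⟨i, h.2⟩, h.1, rfl⟩⟩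
      simp only [hmem, encode, inputState]
      by_cases h : i < n
      · rw [dif_pos h, dif_pos h, hv]
        by_cases h' : i < M
        · simp [h']
        · simp [h', h, not_lt.mp h']
      · simp [h, show ¬ i < M by omega]
    · intro a ha
      obtain ⟨i, -, rfl⟩ := List.mem_map.mp ha
      simp
  obtain ⟨⟨t₀, ht₀, e₀⟩, -⟩ := h₀ φ (inputState L) B fun i => by
    unfold inputState
    split_ifs with h
    · exact hB _
    · simp
  rw [hinit] at e₀
  have hvb : ∀ i, bits (v i) ≤ B + b₀ := by
    intro i
    rw [hv]
    split_ifs with h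
    · exact (hB _).trans (by omega)
    · have := Finset.single_le_sum (f := fun i => bits (init i)) (fun i _ => Nat.zero_le _)
        (Finset.mem_univ i)
      omega
  -- The size bound for all iterates. It is linear in `N + B + 1`, so `N + 1` passes of quadratic
  -- cost give the cubic bound.
  set B' := B + b₀ + N * κ with hB'
  have hit : ∀ k ≤ N, ∀ i, bits ((step l₁)^[k] v i) ≤ B' := by
    intro k hk i
    refine (bits_iterate_step_le hκ hvb k i).trans ?_
    have := Nat.mul_le_mul_right κ hk
    omega
  obtain ⟨t₁, ht₁, e₁⟩ := exec_loop (φ := φ) (T := c₁ * (B' + 1) ^ 2) f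
    (fun w hw => by
      have := (h₁ φ (encode w) B' (bits_encode_le hw)).1
      rwa [eval_cleanStepProg] at this) N v hit hpos hN
  obtain ⟨⟨t₂, ht₂, e₂⟩, -⟩ := h₂ φ (encode ((step l₁)^[N] v)) B' (bits_encode_le (hit N le_rfl))
  rw [eval_cleanStepProg] at e₂
  refine ⟨_, ?_, .seq e₀ (.seq e₁ e₂)⟩
  set S := N + B + 1 with hS
  have hBS : B' + 1 ≤ D * S := by
    have : D * S = (1 + b₀ + κ) * (N + B) + (1 + b₀ + κ) := by rw [hD, hS]; ring
    nlinarith [Nat.zero_le (b₀ * (N + B)), Nat.zero_le (κ * B)]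
  have hS1 : 1 ≤ S := by omega
  have hS2 : S ^ 2 ≤ S ^ 3 := Nat.pow_le_pow_right hS1 (by norm_num)
  have hsq : (B' + 1) ^ 2 ≤ D ^ 2 * S ^ 2 := by
    rw [← mul_pow]; exact Nat.pow_le_pow_left hBS 2
  have i₀ : t₀ ≤ c₀ * S ^ 3 := by
    refine ht₀.trans (Nat.mul_le_mul_left _ (le_trans ?_ hS2))
    exact Nat.pow_le_pow_left (by omega) 2
  have i₁ : t₁ ≤ (1 + c₁) * D ^ 2 * S ^ 3 := by
    calc t₁ ≤ (N + 1) * (1 + B' + c₁ * (B' + 1) ^ 2) := ht₁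
      _ ≤ S * ((1 + c₁) * (D ^ 2 * S ^ 2)) := by
          refine Nat.mul_le_mul (by omega) ?_
          have : B' + 1 ≤ (B' + 1) ^ 2 := Nat.le_self_pow (by norm_num) _
          calc 1 + B' + c₁ * (B' + 1) ^ 2 ≤ (1 + c₁) * (B' + 1) ^ 2 := by nlinarith
            _ ≤ _ := Nat.mul_le_mul_left _ hsq
      _ = _ := by ring
  have i₂ : t₂ ≤ c₂ * D ^ 2 * S ^ 3 := by
    calc t₂ ≤ c₂ * (D ^ 2 * S ^ 2) := ht₂.trans (Nat.mul_le_mul_left _ hsq)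
      _ = c₂ * D ^ 2 * S ^ 2 := by ring
      _ ≤ _ := Nat.mul_le_mul_left _ hS2
  calc t₀ + (t₁ + t₂) ≤ c₀ * S ^ 3 + ((1 + c₁) * D ^ 2 * S ^ 3 + c₂ * D ^ 2 * S ^ 3) := by omega
    _ = _ := by ring

end Machine

end BitMachine

/-! ### Embeddings, totally positive units and generators. -/

section TotallyReal

open NumberField

variable {F : Type*} [Field F] [NumberField F] {d : ℕ} (σ : Fin d ≃ (F →+* ℝ))

/-- The complex embedding over `ℚ` attached to the `k`-th real embedding. -/
noncomputable def complexEmbedding (k : Fin d) : F →ₐ[ℚ] ℂ :=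
  (Complex.ofRealHom.comp (σ k)).toRatAlgHom

theorem complexEmbedding_apply (k : Fin d) (x : F) : complexEmbedding σ k x = (σ k x : ℂ) := rfl

/-- Every complex embedding of a totally real field is real, so the formulas for trace and norm over
`ℂ` can be reindexed by `σ`. -/
theorem complexEmbedding_bijective [IsTotallyReal F] :
    Function.Bijective (complexEmbedding σ) := by
  constructor
  · intro k l h
    refine σ.injective (RingHom.ext fun x => ?_)
    have := DFunLike.congr_fun h x
    simpa [complexEmbedding_apply] using this
  · intro τ
    have hτ := IsTotallyReal.complexEmbedding_isReal τ.toRingHom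
    refine ⟨σ.symm hτ.embedding, AlgHom.ext fun x => ?_⟩
    rw [complexEmbedding_apply, Equiv.apply_symm_apply]
    exact hτ.coe_embedding_apply x

theorem trace_eq_sum [IsTotallyReal F] (x : 𝓞 F) :
    ((Algebra.trace ℤ (𝓞 F) x : ℤ) : ℝ) = ∑ k, σ k (x : F) := by
  have h := trace_eq_sum_embeddings (K := ℚ) (L := F) ℂ (x := (x : F))
  rw [← (complexEmbedding_bijective σ).sum_comp, ← Algebra.coe_trace_int] at h
  simp only [complexEmbedding_apply, eq_ratCast, Rat.cast_intCast] at h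
  exact_mod_cast h

theorem norm_eq_prod [IsTotallyReal F] (x : 𝓞 F) :
    ((Algebra.norm ℤ x : ℤ) : ℝ) = ∏ k, σ k (x : F) := by
  have h := Algebra.norm_eq_prod_embeddings ℚ ℂ (x : F)
  rw [← (complexEmbedding_bijective σ).prod_comp, ← Algebra.coe_norm_int] at h
  simp only [complexEmbedding_apply, eq_ratCast, Rat.cast_intCast] at h
  exact_mod_cast h

theorem absNorm_eq_prod [IsTotallyReal F] {x : 𝓞 F} (hx : IsTotallyPositive σ x) :
    (Ideal.absNorm (Ideal.span {x}) : ℝ) = ∏ k, σ k (x : F) := by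
  rw [Ideal.absNorm_span_singleton, Nat.cast_natAbs, Int.cast_abs, norm_eq_prod σ,
    abs_of_pos (Finset.prod_pos fun k _ => hx k)]

theorem abs_prod_unit [IsTotallyReal F] (u : (𝓞 F)ˣ) : |∏ k, σ k ((u : 𝓞 F) : F)| = 1 := by
  rw [← norm_eq_prod σ, ← Int.cast_abs]
  have := Int.isUnit_iff_abs_eq.mp (u.isUnit.map (Algebra.norm ℤ))
  exact_mod_cast this

/-- The infinite place attached to the `k`-th real embedding. -/
noncomputable def placeOf (k : Fin d) : InfinitePlace F :=
  InfinitePlace.mk (Complex.ofRealHom.comp (σ k))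

omit [NumberField F] in
theorem placeOf_apply (k : Fin d) (x : F) : placeOf σ k x = |σ k x| := by
  simp [placeOf, InfinitePlace.apply]

/-- A place determines its embedding up to conjugation, and conjugation fixes real embeddings. -/
theorem placeOf_bijective [IsTotallyReal F] : Function.Bijective (placeOf σ) := by
  constructor
  · intro k l h
    have h' : Complex.ofRealHom.comp (σ k) = Complex.ofRealHom.comp (σ l) := by
      rcases InfinitePlace.mk_eq_iff.mp h with h | h
      · exact h
      · rw [← h]
        ext x
        simp [ComplexEmbedding.conjugate_coe_eq]
    refine σ.injective (RingHom.ext fun x => ?_)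
    simpa using DFunLike.congr_fun h' x
  · intro w
    obtain ⟨k, hk⟩ := (complexEmbedding_bijective σ).2 (w.embedding.toRatAlgHom)
    refine ⟨k, ?_⟩
    rw [← w.mk_embedding, placeOf]
    congr 1
    ext x
    exact DFunLike.congr_fun hk x

open NumberField.Units NumberField.Units.dirichletUnitTheorem in
/-- The squares of the units form a cocompact lattice. -/
theorem exists_unit_approx [IsTotallyReal F] :
    ∃ K : ℝ, 1 ≤ K ∧ ∀ x : Fin d → ℝ, (∀ k, 0 < x k) → ∏ k, x k = 1 →
      ∃ u : (𝓞 F)ˣ, IsTotallyPositive σ (u : 𝓞 F) ∧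
        ∀ k, K⁻¹ ≤ x k * σ k ((u : 𝓞 F) : F) ∧ x k * σ k ((u : 𝓞 F) : F) ≤ K := by
  classical
  set B := (basisUnitLattice F).ofZLatticeBasis ℝ (unitLattice F) with hB
  set R : ℝ := ∑ i, ‖B i‖ with hR
  have hR0 : 0 ≤ R := Finset.sum_nonneg fun i _ => norm_nonneg _
  set e : Fin d ≃ InfinitePlace F := Equiv.ofBijective _ (placeOf_bijective σ) with he
  have hd : 1 ≤ d := Fin.pos (e.symm w₀)
  refine ⟨Real.exp (2 * (d * R)), Real.one_le_exp (by positivity), fun x hx hprod => ?_⟩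
  -- The logarithms are halved because the unit found here is squared at the end to make it totally
  -- positive.
  set m : logSpace F := fun w => Real.log (x (e.symm w)) / 2 with hm
  have hfl : (-(ZSpan.floor B m : logSpace F)) ∈ unitLattice F := by
    have h : ((ZSpan.floor B m : logSpace F)) ∈ Submodule.span ℤ (Set.range B) :=
      (ZSpan.floor B m).2
    exact neg_mem ((Module.Basis.ofZLatticeBasis_span ℝ (unitLattice F)
      (basisUnitLattice F)).le h)
  obtain ⟨v, -, hv⟩ := hfl
  set u : (𝓞 F)ˣ := Additive.toMul v with hu
  have hfr : ‖ZSpan.fract B m‖ ≤ R := ZSpan.norm_fract_le B m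
  set a : Fin d → ℝ := fun k => Real.log |σ k ((u : 𝓞 F) : F)| + Real.log (x k) / 2 with ha
  have hu0 : ∀ k, σ k ((u : 𝓞 F) : F) ≠ 0 := fun k =>
    (map_ne_zero _).mpr (RingOfIntegers.coe_ne_zero_iff.mpr u.ne_zero)
  -- The logarithmic space omits the place `w₀`; the product formula recovers that coordinate from
  -- the others, at the price of a factor `d`.
  have hsum : ∑ k, a k = 0 := by
    rw [ha, Finset.sum_add_distrib, ← Finset.sum_div,
      ← Real.log_prod (fun k _ => (hx k).ne'), hprod,
      ← Real.log_prod (fun k _ => abs_ne_zero.mpr (hu0 k)), ← Finset.abs_prod, abs_prod_unit]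
    simp
  have hak : ∀ k, k ≠ e.symm w₀ → |a k| ≤ R := by
    intro k hk
    have hw : e k ≠ w₀ := fun h => hk (by rw [← h, e.symm_apply_apply])
    have h₁ : ZSpan.fract B m ⟨e k, hw⟩ = a k := by
      have : ZSpan.fract B m = m + (logEmbedding F).toIntLinearMap v := by
        rw [hv, ZSpan.fract_apply, sub_eq_add_neg]
      rw [this]
      have h₂ : (logEmbedding F).toIntLinearMap v ⟨e k, hw⟩
          = Real.log |σ k ((u : 𝓞 F) : F)| := by
        change logEmbedding F (Additive.ofMul u) ⟨e k, hw⟩ = _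
        rw [logEmbedding_component, IsTotallyReal.mult_eq, Nat.cast_one, one_mul]
        exact congrArg Real.log (placeOf_apply σ k _)
      rw [Pi.add_apply, h₂, add_comm]
      simp [hm, ha]
    rw [← h₁, ← Real.norm_eq_abs]
    exact (norm_le_pi_norm _ _).trans hfr
  have hall : ∀ k, |a k| ≤ d * R := by
    intro k
    by_cases hk : k = e.symm w₀
    · have h₁ : a k = -∑ l ∈ Finset.univ.erase k, a l := by
        rw [← Finset.add_sum_erase _ _ (Finset.mem_univ k)] at hsum
        linarith
      rw [h₁, abs_neg]
      calc |∑ l ∈ Finset.univ.erase k, a l| ≤ ∑ l ∈ Finset.univ.erase k, |a l| :=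
            Finset.abs_sum_le_sum_abs _ _
        _ ≤ ∑ l ∈ Finset.univ.erase k, R :=
            Finset.sum_le_sum fun l hl => hak l (hk ▸ Finset.ne_of_mem_erase hl)
        _ ≤ ∑ l : Fin d, R :=
            Finset.sum_le_sum_of_subset_of_nonneg (Finset.erase_subset _ _) fun _ _ _ => hR0
        _ = d * R := by simp
    · have : (1 : ℝ) ≤ d := by exact_mod_cast hd
      exact (hak k hk).trans (by nlinarith)
  have hval : ∀ k, x k * σ k (((u ^ 2 : (𝓞 F)ˣ) : 𝓞 F) : F) = Real.exp (2 * a k) := by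
    intro k
    have h₁ : Real.exp (2 * a k) = |σ k ((u : 𝓞 F) : F)| ^ 2 * x k := by
      rw [show 2 * a k = Real.log (|σ k ((u : 𝓞 F) : F)|) + Real.log (|σ k ((u : 𝓞 F) : F)|)
        + Real.log (x k) by simp only [ha]; ring, Real.exp_add, Real.exp_add,
        Real.exp_log (hx k), Real.exp_log (abs_pos.mpr (hu0 k)), sq]
    rw [h₁, sq_abs, mul_comm]
    simp
  refine ⟨u ^ 2, fun k => ?_, fun k => ?_⟩
  · have := Real.exp_pos (2 * a k)
    rw [← hval] at this
    exact pos_of_mul_pos_right this (hx k).le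
  · rw [hval, ← Real.exp_neg]
    have := abs_le.mp (hall k)
    constructor <;> apply Real.exp_le_exp.mpr <;> linarith

/-- There are totally positive integers which are much larger at one embedding than at the others. -/
theorem exists_dominant [IsTotallyReal F] (H : ℝ) (hH : 1 ≤ H) (k : Fin d) :
    ∃ θ : 𝓞 F, IsTotallyPositive σ θ ∧ ∀ l, l ≠ k → σ l (θ : F) * H ≤ σ k (θ : F) := by
  obtain ⟨K, hK, h⟩ := exists_unit_approx σ
  have hK0 : 0 < K := by linarith
  -- With target `c` at `l ≠ k` one gets `σ l u ≤ K / c`, that is `σ l u * H ≤ K⁻¹`, while `σ k u ≥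
  -- K⁻¹`.
  set c : ℝ := K ^ 2 * H with hc
  have hc1 : 1 ≤ c := by nlinarith [one_le_pow₀ hK (n := 2)]
  have hc0 : 0 < c := by linarith
  obtain ⟨u, hu, hux⟩ := h (fun l => if l = k then (c ^ (d - 1))⁻¹ else c)
    (fun l => by split_ifs <;> positivity) (by
      rw [← Finset.mul_prod_erase _ _ (Finset.mem_univ k), if_pos rfl,
        Finset.prod_congr rfl fun l hl => if_neg (Finset.ne_of_mem_erase hl)]
      simp [Finset.card_erase_of_mem, hc0.ne'])
  refine ⟨u, hu, fun l hl => ?_⟩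
  have hk := (hux k).1
  have h₁ := (hux l).2
  simp only [if_true, if_neg hl] at hk h₁
  have hk' : K⁻¹ ≤ σ k ((u : 𝓞 F) : F) := by
    refine hk.trans (mul_le_of_le_one_left (hu k).le ?_)
    exact inv_le_one_of_one_le₀ (one_le_pow₀ hc1)
  refine le_trans ?_ hk'
  rw [inv_eq_one_div, le_div_iff₀ hK0]
  have : K * (σ l ((u : 𝓞 F) : F) * H * K) ≤ K * 1 := by
    calc _ = c * σ l ((u : 𝓞 F) : F) := by rw [hc]; ring
      _ ≤ _ := by linarith
  exact le_of_mul_le_mul_left this hK0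

/-- Units move all but one of the coordinates into windows. -/
theorem exists_unit_window [IsTotallyReal F] [NeZero d] :
    ∃ K : ℝ, 1 ≤ K ∧ ∀ x : Fin d → ℝ, (∀ k, 0 < x k) →
      ∃ u : (𝓞 F)ˣ, IsTotallyPositive σ (u : 𝓞 F) ∧
        ∀ k, k ≠ 0 → 1 ≤ x k * σ k ((u : 𝓞 F) : F) ∧ x k * σ k ((u : 𝓞 F) : F) ≤ K := by
  obtain ⟨K, hK, h⟩ := exists_unit_approx σ
  have hK0 : 0 < K := by linarith
  refine ⟨K * K, by nlinarith, fun x hx => ?_⟩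
  set P := ∏ l ∈ Finset.univ.erase (0 : Fin d), (x l / K) with hP
  have hP0 : 0 < P := Finset.prod_pos fun l _ => div_pos (hx l) hK0
  -- Coordinate `0` is free and absorbs the condition that the product is `1`. Dividing the others
  -- by `K` turns the window from `K⁻¹` to `K` into that from `1` to `K * K`.
  obtain ⟨u, hu, hux⟩ := h (fun l => if l = 0 then P⁻¹ else x l / K)
    (fun l => by
      split_ifs
      · positivity
      · exact div_pos (hx l) hK0) (by
      rw [← Finset.mul_prod_erase _ _ (Finset.mem_univ (0 : Fin d)), if_pos rfl,
        Finset.prod_congr rfl fun l hl => if_neg (Finset.ne_of_mem_erase hl)]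
      exact inv_mul_cancel₀ hP0.ne')
  refine ⟨u, hu, fun k hk => ?_⟩
  have := hux k
  rw [if_neg hk, div_mul_eq_mul_div, div_le_iff₀ hK0, le_div_iff₀ hK0,
    inv_mul_cancel₀ hK0.ne'] at this
  exact this

omit [NumberField F] in
theorem IsTotallyPositive.mul {σ : Fin d ≃ (F →+* ℝ)} {x y : 𝓞 F} (hx : IsTotallyPositive σ x)
    (hy : IsTotallyPositive σ y) : IsTotallyPositive σ (x * y) := fun k => by
  simpa using mul_pos (hx k) (hy k)

omit [NumberField F] in
theorem isTotallyPositive_one : IsTotallyPositive σ 1 := fun k => by simp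

/-- A fixed power of every nonzero ideal has a totally positive generator. -/
theorem exists_pow_hasTotallyPositiveGenerator :
    ∃ h : ℕ, 0 < h ∧ ∀ I : Ideal (𝓞 F), I ≠ ⊥ → HasTotallyPositiveGenerator σ (I ^ h) := by
  refine ⟨classNumber F * 2, by have := classNumber_pos F; omega, fun I hI => ?_⟩
  have hI' : I ∈ nonZeroDivisors (Ideal (𝓞 F)) := mem_nonZeroDivisors_of_ne_zero hI
  have h₁ : ClassGroup.mk0 ⟨I ^ classNumber F, pow_mem hI' _⟩ = 1 := by
    have : (⟨I ^ classNumber F, pow_mem hI' _⟩ : nonZeroDivisors (Ideal (𝓞 F)))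
      = ⟨I, hI'⟩ ^ classNumber F := rfl
    rw [this, map_pow]
    exact pow_card_eq_one
  obtain ⟨a, ha⟩ := ((ClassGroup.mk0_eq_one_iff _).mp h₁).principal
  have ha' : I ^ classNumber F = Ideal.span {a} := ha
  have ha0 : a ≠ 0 := by
    rintro rfl
    rw [Ideal.span_singleton_eq_bot.mpr rfl] at ha'
    exact pow_ne_zero _ hI ha'
  refine ⟨a ^ 2, fun k => ?_, ?_⟩
  · have : σ k (a : F) ≠ 0 := (map_ne_zero _).mpr (RingOfIntegers.coe_ne_zero_iff.mpr ha0)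
    simp only [map_pow]
    positivity
  · rw [pow_mul, ha', Ideal.span_singleton_pow]

/-- A generator of the product lies in the ideal of `α`; its quotient by `α` is totally positive,
and `α` cancels from the ideals. -/
theorem hasTotallyPositiveGenerator_mul_iff {α : 𝓞 F} (hα : IsTotallyPositive σ α) (hα0 : α ≠ 0)
    (J : Ideal (𝓞 F)) :
    HasTotallyPositiveGenerator σ (Ideal.span {α} * J) ↔ HasTotallyPositiveGenerator σ J := by
  constructor
  · rintro ⟨r, hr, hrJ⟩
    have hmem : r ∈ Ideal.span {α} := by
      have : r ∈ Ideal.span {α} * J := by rw [← hrJ]; exact Ideal.mem_span_singleton_self r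
      exact (Ideal.mul_le_inf this).1
    obtain ⟨q, rfl⟩ := Ideal.mem_span_singleton.mp hmem
    refine ⟨q, fun k => ?_, ?_⟩
    · have := hr k
      simp only [map_mul] at this
      exact pos_of_mul_pos_right this (hα k).le
    · rw [← Ideal.span_singleton_mul_span_singleton] at hrJ
      exact mul_left_cancel₀ (by simpa using hα0) hrJ
  · rintro ⟨r, hr, rfl⟩
    exact ⟨α * r, hα.mul hr, by rw [Ideal.span_singleton_mul_span_singleton]⟩

end TotallyReal

/-! ### Programs acting on free modules of finite rank. -/

namespace BitMachine

/-- Coordinates on the product of `ℤ ^ n₀` and a free module of finite rank. -/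
theorem exists_coordinates (n₀ : ℕ) (W : Type*) [AddCommGroup W] [Module.Free ℤ W]
    [Module.Finite ℤ W] :
    ∃ (n₁ : ℕ) (e : (Fin (n₀ + n₁) → ℤ) ≃ₗ[ℤ] ((Fin n₀ → ℤ) × W)) (g : W → Fin n₁ → ℤ),
      (∀ w i, e.symm w (Fin.castAdd n₁ i) = w.1 i) ∧
        ∀ w i, e.symm w (Fin.natAdd n₀ i) = g w.2 i := by
  refine ⟨_, (LinearEquiv.funCongrLeft ℤ ℤ finSumFinEquiv).trans
    ((LinearEquiv.sumArrowLequivProdArrow _ _ ℤ ℤ).trans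
      (LinearEquiv.prodCongr (LinearEquiv.refl ℤ _) (Module.finBasis ℤ W).equivFun.symm)),
    (Module.finBasis ℤ W).equivFun, fun w i => ?_, fun w i => ?_⟩
  · simp [LinearEquiv.funCongrLeft, LinearEquiv.sumArrowLequivProdArrow]
  · simp [LinearEquiv.funCongrLeft, LinearEquiv.sumArrowLequivProdArrow]

/-- Iterated conditional linear maps of a free module of finite rank are computed in time cubic in
the number of iterations and the size of the input. -/
theorem exists_prog_of_options {M n₀ : ℕ} (hM : M ≤ n₀) {W : Type*} [AddCommGroup W]
    [Module.Free ℤ W] [Module.Finite ℤ W] (init : (Fin n₀ → ℤ) × W) (f : Fin n₀)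
    (l₁ l₂ : List (List (((Fin n₀ → ℤ) × W) →ₗ[ℤ] ℤ) ×
      (((Fin n₀ → ℤ) × W) →ₗ[ℤ] ((Fin n₀ → ℤ) × W)))) :
    ∃ (P : Prog) (c : ℕ), ∀ (φ : ℕ → ℤ) (L : Fin M → ℕ) (v : (Fin n₀ → ℤ) × W) (N B : ℕ),
      (∀ i : Fin n₀, v.1 i = if h : (i : ℕ) < M then (L ⟨i, h⟩ : ℤ) else init.1 i) →
      v.2 = init.2 →
      (∀ j, bits (L j) ≤ B) →
      (∀ k < N, 0 < ((step l₁)^[k] v).1 f) → ((step l₁)^[N] v).1 f ≤ 0 →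
      ∃ t ≤ c * (N + B + 1) ^ 3, ∃ s : State, Exec φ P (inputState L) s t ∧
        ∀ i : Fin n₀, s i = (step l₂ ((step l₁)^[N] v)).1 i := by
  obtain ⟨n₁, e, g, he', hg⟩ := exists_coordinates n₀ W
  obtain ⟨P, c, hP⟩ := exists_prog_iterate_step (n := n₀ + n₁) (by omega : M ≤ n₀ + n₁)
    (e.symm init) (Fin.castAdd n₁ f) (conjOptions e l₁) (conjOptions e l₂)
  refine ⟨P, c, fun φ L v N B hv hv₂ hB hpos hN => ?_⟩
  have hit : ∀ k, (step (conjOptions e l₁))^[k] (e.symm v) = e.symm ((step l₁)^[k] v) := by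
    intro k
    induction k with
    | zero => rfl
    | succ k ih => rw [Function.iterate_succ_apply', Function.iterate_succ_apply', ih,
        step_conjOptions]
  have hinit : ∀ i : Fin (n₀ + n₁),
      e.symm v i = if h : (i : ℕ) < M then (L ⟨i, h⟩ : ℤ) else e.symm init i := by
    intro i
    refine Fin.addCases (fun i => ?_) (fun i => ?_) i
    · rw [he', he', hv]
      rfl
    · rw [hg, hg, hv₂, dif_neg (by simp; omega)]
  obtain ⟨t, ht, hex⟩ := hP φ L (e.symm v) N B hinit hB
    (fun k hk => by rw [hit, he']; exact hpos k hk) (by rw [hit, he']; exact hN)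
  refine ⟨t, ht, _, hex, fun i => ?_⟩
  rw [hit, step_conjOptions, ← he' _ i, encode, dif_pos (by omega)]
  rfl

end BitMachine

/-! ### Candidate multipliers and approximation of embeddings by traces. -/

section Reduction

open NumberField BitMachine

variable {F : Type*} [Field F] [NumberField F] {d : ℕ} (σ : Fin d ≃ (F →+* ℝ))

/-- Finitely many totally positive generators of an ideal suffice to move every bounded vector
into a window which does not depend on the bound. -/
theorem exists_candidates [IsTotallyReal F] [NeZero d] (lo : ℝ) (hlo : 0 < lo) :
    ∃ hi : ℝ, ∀ (X : ℕ) (I : Ideal (𝓞 F)), I ≠ ⊥ → HasTotallyPositiveGenerator σ I →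
      ∃ G : Finset (𝓞 F), (∀ g ∈ G, IsTotallyPositive σ g ∧ Ideal.span {g} = I) ∧
        ∀ x : Fin d → ℝ, (∀ k, k ≠ 0 → 1 ≤ x k ∧ x k ≤ X) →
          ∃ g ∈ G, ∀ k, k ≠ 0 → lo ≤ x k * σ k (g : F) ∧ x k * σ k (g : F) ≤ hi := by
  classical
  obtain ⟨K, hK, h⟩ := exists_unit_window σ
  refine ⟨2 * lo * K, fun X I hI ⟨α, hα, hαI⟩ => ?_⟩
  -- One unit is chosen for each point of a finite grid. The bound `X` affects only the number of
  -- candidates, not the window.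
  choose u hu hux using fun m : Fin d → Fin (X + 1) =>
    h (fun k => ((m k : ℕ) + 1) * σ k (α : F) / (2 * lo)) fun k => by
      have := hα k
      positivity
  refine ⟨Finset.univ.image fun m => α * (u m : 𝓞 F), fun g hg => ?_, fun x hx => ?_⟩
  · obtain ⟨m, -, rfl⟩ := Finset.mem_image.mp hg
    refine ⟨hα.mul (hu m), ?_⟩
    rw [Ideal.span_singleton_mul_right_unit (u m).isUnit, hαI]
  · set m : Fin d → Fin (X + 1) := fun k => ⟨min ⌊x k⌋₊ X, by omega⟩ with hm
    refine ⟨_, Finset.mem_image_of_mem _ (Finset.mem_univ m), fun k hk => ?_⟩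
    obtain ⟨hx₁, hx₂⟩ := hx k hk
    have hfl : ⌊x k⌋₊ ≤ X := Nat.floor_le_of_le hx₂
    have hmk : ((m k : ℕ) : ℝ) = (⌊x k⌋₊ : ℝ) := by simp [hm, hfl]
    have h₁ : ((m k : ℕ) : ℝ) ≤ x k := hmk ▸ Nat.floor_le (by linarith)
    have h₂ : x k ≤ (m k : ℕ) + 1 := hmk ▸ (Nat.lt_floor_add_one (x k)).le
    have hpos : 0 < σ k (α : F) * σ k ((u m : 𝓞 F) : F) := mul_pos (hα k) (hu m k)
    have hw := hux m k hk
    rw [div_mul_eq_mul_div, le_div_iff₀ (by positivity), div_le_iff₀ (by positivity)] at hw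
    simp only [map_mul]
    constructor
    · nlinarith [mul_le_mul_of_nonneg_right (show ((m k : ℕ) : ℝ) + 1 ≤ 2 * x k by linarith) hpos.le]
    · nlinarith [mul_le_mul_of_nonneg_right h₂ hpos.le]

variable {σ}

/-- Traces of high multiples of a dominant element approximate a single embedding. -/
theorem trace_mul_pow_bounds [IsTotallyReal F] {H : ℝ} (hH : 0 ≤ H) {k : Fin d} {θ : 𝓞 F}
    (hθ : IsTotallyPositive σ θ) (hdom : ∀ l, l ≠ k → σ l (θ : F) * H ≤ σ k (θ : F)) {x : 𝓞 F}
    (hx : IsTotallyPositive σ x) {n : ℕ} (hxH : ∀ l, σ l (x : F) ≤ H ^ n) :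
    σ k (x : F) * σ k (θ : F) ^ n ≤ (Algebra.trace ℤ (𝓞 F) (x * θ ^ n) : ℤ) ∧
      (Algebra.trace ℤ (𝓞 F) (x * θ ^ n) : ℤ) ≤ (σ k (x : F) + d) * σ k (θ : F) ^ n := by
  have hS : 0 < σ k (θ : F) ^ n := pow_pos (hθ k) n
  have hterm : ∀ l, 0 < σ l (x : F) * σ l (θ : F) ^ n := fun l =>
    mul_pos (hx l) (pow_pos (hθ l) n)
  rw [trace_eq_sum σ]
  simp only [map_mul, map_pow]
  rw [← Finset.add_sum_erase _ _ (Finset.mem_univ k)]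
  refine ⟨le_add_of_nonneg_right (Finset.sum_nonneg fun l _ => (hterm l).le), ?_⟩
  rw [add_mul]
  gcongr
  calc ∑ l ∈ Finset.univ.erase k, σ l (x : F) * σ l (θ : F) ^ n
      ≤ ∑ l ∈ Finset.univ.erase k, σ k (θ : F) ^ n := by
        refine Finset.sum_le_sum fun l hl => ?_
        have h₁ := hdom l (Finset.ne_of_mem_erase hl)
        calc σ l (x : F) * σ l (θ : F) ^ n ≤ H ^ n * σ l (θ : F) ^ n :=
              mul_le_mul_of_nonneg_right (hxH l) (pow_pos (hθ l) n).le
          _ = (σ l (θ : F) * H) ^ n := by rw [mul_pow, mul_comm]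
          _ ≤ σ k (θ : F) ^ n := by
              exact pow_le_pow_left₀ (mul_nonneg (hθ l).le hH) h₁ n
    _ ≤ ∑ l : Fin d, σ k (θ : F) ^ n :=
        Finset.sum_le_sum_of_subset_of_nonneg (Finset.erase_subset _ _) fun _ _ _ => hS.le
    _ = d * σ k (θ : F) ^ n := by simp

end Reduction

/-! ### One step of the reduction. -/

section Reduction

open NumberField BitMachine

variable {F : Type*} [Field F] [NumberField F] {d : ℕ}

/-- The constants used by the reduction: generators of the `h`-th powers of the given ideals, and an
element dominant at each embedding. -/
structure ReductionData [NeZero d] (σ : Fin d ≃ (F →+* ℝ)) {M : ℕ} (p : Fin M → Ideal (𝓞 F)) where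
  h : ℕ
  h_pos : 0 < h
  bound : ℕ
  H : ℝ
  one_le_H : 1 ≤ H
  θ : Fin d → 𝓞 F
  θ_pos : ∀ k, IsTotallyPositive σ (θ k)
  θ_dom : ∀ k l, l ≠ k → σ l (θ k : F) * H ≤ σ k (θ k : F)
  cand : Fin M → Finset (𝓞 F)
  cand_pos : ∀ j, ∀ g ∈ cand j, IsTotallyPositive σ g
  cand_span : ∀ j, ∀ g ∈ cand j, Ideal.span {g} = p j ^ h
  cand_le : ∀ j, ∀ g ∈ cand j, ∀ l, σ l (g : F) ≤ H
  exists_cand : ∀ j (x : Fin d → ℝ), (∀ k, k ≠ 0 → 1 ≤ x k ∧ x k ≤ (d + 1) * bound) →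
    ∃ g ∈ cand j, ∀ k, k ≠ 0 →
      ((d + 1) ^ 2 + 1 : ℝ) ≤ x k * σ k (g : F) ∧ x k * σ k (g : F) + d < bound
  one_le_bound : 1 ≤ bound

/-- The order of choices avoids circularity. The window of `exists_candidates` is fixed first and
determines `bound`; the candidates are then made to handle inputs up to `(d + 1) * bound`, the
weaker bound that the trace tests guarantee; `H` dominates the candidates, and `θ` is chosen last.
-/
theorem nonempty_reductionData [IsTotallyReal F] [NeZero d] (σ : Fin d ≃ (F →+* ℝ)) {M : ℕ}
    (p : Fin M → Ideal (𝓞 F)) (hp0 : ∀ j, p j ≠ ⊥) : Nonempty (ReductionData σ p) := by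
  obtain ⟨h, hh, hgen⟩ := exists_pow_hasTotallyPositiveGenerator σ
  obtain ⟨hi, hhi⟩ := exists_candidates σ ((d + 1) ^ 2 + 1) (by positivity)
  set b : ℕ := ⌈hi⌉₊ + d + 1 with hb
  choose G hG₁ hG₂ using fun j => hhi ((d + 1) * b) (p j ^ h) (pow_ne_zero h (hp0 j)) (hgen _ (hp0 j))
  set H : ℝ := 1 + ∑ j, ∑ g ∈ G j, ∑ l, |σ l (g : F)| with hH
  have hH1 : 1 ≤ H := by
    have : 0 ≤ ∑ j, ∑ g ∈ G j, ∑ l, |σ l (g : F)| := by positivity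
    linarith
  choose θ hθ₁ hθ₂ using exists_dominant σ H hH1
  refine ⟨⟨h, hh, b, H, hH1, θ, hθ₁, hθ₂, G, fun j g hg => (hG₁ j g hg).1,
    fun j g hg => (hG₁ j g hg).2, fun j g hg l => ?_, fun j x hx => ?_, by omega⟩⟩
  · have h₁ : |σ l (g : F)| ≤ ∑ l, |σ l (g : F)| :=
      Finset.single_le_sum (f := fun l => |σ l (g : F)|) (fun _ _ => abs_nonneg _)
        (Finset.mem_univ l)
    have h₂ : ∑ l, |σ l (g : F)| ≤ ∑ g ∈ G j, ∑ l, |σ l (g : F)| :=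
      Finset.single_le_sum (f := fun g : 𝓞 F => ∑ l, |σ l (g : F)|) (fun _ _ => by positivity) hg
    have h₃ : ∑ g ∈ G j, ∑ l, |σ l (g : F)| ≤ ∑ j, ∑ g ∈ G j, ∑ l, |σ l (g : F)| :=
      Finset.single_le_sum (f := fun j => ∑ g ∈ G j, ∑ l, |σ l (g : F)|)
        (fun _ _ => by positivity) (Finset.mem_univ j)
    have := le_abs_self (σ l (g : F))
    linarith
  · obtain ⟨g, hg, hgx⟩ := hG₂ j x (by simpa using hx)
    refine ⟨g, hg, fun k hk => ⟨(hgx k hk).1, ?_⟩⟩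
    have h₁ := (hgx k hk).2
    have h₂ := Nat.le_ceil hi
    rw [hb]
    push_cast
    linarith

variable (F) in
/-- Scalars and algebraic integers on which the algorithm operates: the exponents, the output, the
constant `1` and a flag; the generator and its multiples by powers of the dominant elements; these
powers. -/
abbrev Vec (M d : ℕ) : Type _ := (Fin (M + d + 3) → ℤ) × 𝓞 F × (Fin d → 𝓞 F) × (Fin d → 𝓞 F)

/-- The index of an exponent. -/
def expIdx {M d : ℕ} (j : Fin M) : Fin (M + d + 3) := ⟨j, by omega⟩

/-- The index of the constant `1`. -/
def oneIdx (M d : ℕ) : Fin (M + d + 3) := ⟨M + d + 1, by omega⟩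

/-- The index of the flag. -/
def flagIdx (M d : ℕ) : Fin (M + d + 3) := ⟨M + d + 2, by omega⟩

/-- The scalars with given exponents and flag. -/
def scalars {M : ℕ} (d : ℕ) (L : Fin M → ℕ) (f : ℤ) : Fin (M + d + 3) → ℤ := fun i =>
  if h : (i : ℕ) < M then (L ⟨i, h⟩ : ℤ) else if i = oneIdx M d then 1
    else if i = flagIdx M d then f else 0

@[simp] theorem scalars_expIdx {M : ℕ} (L : Fin M → ℕ) (f : ℤ) (j : Fin M) :
    scalars d L f (expIdx j) = L j := by
  simp [scalars, expIdx]

@[simp] theorem scalars_oneIdx {M : ℕ} (L : Fin M → ℕ) (f : ℤ) :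
    scalars d L f (oneIdx M d) = 1 := by
  simp [scalars, oneIdx]; omega

@[simp] theorem scalars_flagIdx {M : ℕ} (L : Fin M → ℕ) (f : ℤ) :
    scalars d L f (flagIdx M d) = f := by
  simp [scalars, oneIdx, flagIdx]; omega

variable [NeZero d] {σ : Fin d ≃ (F →+* ℝ)} {M : ℕ} {p : Fin M → Ideal (𝓞 F)}
  (D : ReductionData σ p)

namespace ReductionData

/-- The vector which represents the remaining exponents `L`, the generator `r` of the product
of the ideals treated so far, and the number `t` of steps made. -/
noncomputable def vec (L : Fin M → ℕ) (r : 𝓞 F) (t : ℕ) (f : ℤ) : Vec F M d :=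
  (scalars d L f, r, fun k => r * D.θ k ^ t, fun k => D.θ k ^ t)

/-- Positive if and only if the exponent `j` is at least `c`. -/
noncomputable def geForm (F : Type*) [Field F] [NumberField F] {M : ℕ} (d : ℕ) (j : Fin M)
    (c : ℤ) : Vec F M d →ₗ[ℤ] ℤ where
  toFun v := v.1 (expIdx j) - (c - 1) * v.1 (oneIdx M d)
  map_add' v w := by simp only [Prod.fst_add, Pi.add_apply]; ring
  map_smul' c v := by simp only [Prod.smul_fst, Pi.smul_apply, smul_eq_mul, RingHom.id_apply]; ring

/-- Positive if and only if the exponent `j` is at most `c`. -/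
noncomputable def leForm (F : Type*) [Field F] [NumberField F] {M : ℕ} (d : ℕ) (j : Fin M)
    (c : ℤ) : Vec F M d →ₗ[ℤ] ℤ where
  toFun v := (c + 1) * v.1 (oneIdx M d) - v.1 (expIdx j)
  map_add' v w := by simp only [Prod.fst_add, Pi.add_apply]; ring
  map_smul' c v := by simp only [Prod.smul_fst, Pi.smul_apply, smul_eq_mul, RingHom.id_apply]; ring

/-- Positive if the multiple of the generator by `g` is large enough at the embedding `k`. -/
noncomputable def lowForm (g : 𝓞 F) (k : Fin d) : Vec F M d →ₗ[ℤ] ℤ where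
  toFun v := Algebra.trace ℤ (𝓞 F) (g * D.θ k * v.2.2.1 k)
    - (d + 1) * Algebra.trace ℤ (𝓞 F) (D.θ k * v.2.2.2 k)
  map_add' v w := by
    simp only [Prod.snd_add, Prod.fst_add, Pi.add_apply, mul_add, map_add]; ring
  map_smul' c v := by
    simp only [Prod.smul_fst, Prod.smul_snd, Pi.smul_apply, smul_eq_mul, RingHom.id_apply,
      mul_smul_comm, map_zsmul]
    ring

/-- Positive if the multiple of the generator by `g` is small enough at the embedding `k`. -/
noncomputable def highForm (g : 𝓞 F) (k : Fin d) : Vec F M d →ₗ[ℤ] ℤ where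
  toFun v := D.bound * Algebra.trace ℤ (𝓞 F) (D.θ k * v.2.2.2 k)
    - Algebra.trace ℤ (𝓞 F) (g * D.θ k * v.2.2.1 k)
  map_add' v w := by
    simp only [Prod.snd_add, Prod.fst_add, Pi.add_apply, mul_add, map_add]; ring
  map_smul' c v := by
    simp only [Prod.smul_fst, Prod.smul_snd, Pi.smul_apply, smul_eq_mul, RingHom.id_apply,
      mul_smul_comm, map_zsmul]
    ring

/-- The generator is multiplied by `g`, and the exponent `j` is decreased by `h`. -/
noncomputable def advance (j : Fin M) (g : 𝓞 F) : Vec F M d →ₗ[ℤ] Vec F M d where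
  toFun v := (v.1 - (D.h * v.1 (oneIdx M d)) • Pi.single (expIdx j) 1, v.2.1 * g,
    fun k => g * D.θ k * v.2.2.1 k, fun k => D.θ k * v.2.2.2 k)
  map_add' v w := by
    refine Prod.ext ?_ (Prod.ext ?_ (Prod.ext ?_ ?_))
    · simp only [Prod.fst_add, Pi.add_apply, mul_add, add_smul]; abel
    · simp [add_mul]
    · ext1 k; simp [mul_add]
    · ext1 k; simp [mul_add]
  map_smul' c v := by
    refine Prod.ext ?_ (Prod.ext ?_ (Prod.ext ?_ ?_))
    · simp only [Prod.smul_fst, Pi.smul_apply, RingHom.id_apply, smul_sub, smul_smul, smul_eq_mul]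
      congr 2; ring
    · simp [mul_assoc]
    · ext1 k; simp [mul_left_comm]
    · ext1 k; simp [mul_left_comm]

omit [NumberField F] in
theorem advance_vec {j : Fin M} {L : Fin M → ℕ} (hL : D.h ≤ L j) (g r : 𝓞 F) (t : ℕ) (f : ℤ) :
    D.advance j g (D.vec L r t f) =
      D.vec (Function.update L j (L j - D.h)) (r * g) (t + 1) f := by
  refine Prod.ext (funext fun i => ?_) (Prod.ext rfl (Prod.ext ?_ ?_))
  · simp only [advance, vec, LinearMap.coe_mk, AddHom.coe_mk, scalars_oneIdx, mul_one,
      Pi.sub_apply, Pi.smul_apply, smul_eq_mul]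
    rcases eq_or_ne i (expIdx j) with rfl | hi
    · simp [Nat.cast_sub hL]
    · rw [Pi.single_eq_of_ne hi, mul_zero, sub_zero]
      unfold scalars
      split_ifs with h₁
      · rw [Function.update_of_ne]
        rintro rfl
        exact hi rfl
      all_goals rfl
  · ext1 k; simp only [advance, vec, LinearMap.coe_mk, AddHom.coe_mk]; ring
  · ext1 k; simp only [advance, vec, LinearMap.coe_mk, AddHom.coe_mk]; ring

variable (F M d) in
/-- The flag is cleared. -/
noncomputable def finish : Vec F M d →ₗ[ℤ] Vec F M d where
  toFun v := (Function.update v.1 (flagIdx M d) 0, v.2)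
  map_add' v w := by
    refine Prod.ext (funext fun i => ?_) rfl
    rcases eq_or_ne i (flagIdx M d) with rfl | hi <;> simp [*]
  map_smul' c v := by
    refine Prod.ext (funext fun i => ?_) rfl
    rcases eq_or_ne i (flagIdx M d) with rfl | hi <;> simp [*]

omit [NumberField F] in
theorem finish_vec (L : Fin M → ℕ) (r : 𝓞 F) (t : ℕ) (f : ℤ) :
    finish F d M (D.vec L r t f) = D.vec L r t 0 := by
  refine Prod.ext (funext fun i => ?_) rfl
  simp only [finish, vec, LinearMap.coe_mk, AddHom.coe_mk]
  rcases eq_or_ne i (flagIdx M d) with rfl | hi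
  · simp
  · simp [scalars, hi]

/-- One step of the reduction which multiplies the generator by `g`. -/
noncomputable def option (j : Fin M) (g : 𝓞 F) :
    List (Vec F M d →ₗ[ℤ] ℤ) × (Vec F M d →ₗ[ℤ] Vec F M d) :=
  (geForm F d j D.h :: ((Finset.univ.erase (0 : Fin d)).toList.map (D.lowForm g) ++
    (Finset.univ.erase (0 : Fin d)).toList.map (D.highForm g)), D.advance j g)

/-- All the steps of the reduction which multiply the generator. -/
noncomputable def options : List (List (Vec F M d →ₗ[ℤ] ℤ) × (Vec F M d →ₗ[ℤ] Vec F M d)) :=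
  (List.finRange M).flatMap fun j => (D.cand j).toList.map (D.option j)

/-- The steps of the reduction. -/
noncomputable def loopOptions : List (List (Vec F M d →ₗ[ℤ] ℤ) × (Vec F M d →ₗ[ℤ] Vec F M d)) :=
  D.options ++ [([], finish F d M)]

/-- The conditions on the generator which hold throughout the reduction. -/
def Reduced (r : 𝓞 F) (t : ℕ) : Prop :=
  IsTotallyPositive σ r ∧ (∀ l, σ l (r : F) ≤ D.H ^ t) ∧
    ∀ k, k ≠ 0 → 1 ≤ σ k (r : F) ∧ σ k (r : F) ≤ (d + 1) * D.bound

omit [NumberField F] in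
theorem reduced_one : D.Reduced 1 0 := by
  refine ⟨isTotallyPositive_one σ, fun l => by simp, fun k _ => ⟨by simp, ?_⟩⟩
  have h₁ : (1 : ℝ) ≤ d + 1 := by simp
  have h₂ : (1 : ℝ) ≤ D.bound := by exact_mod_cast D.one_le_bound
  simpa using one_le_mul_of_one_le_of_one_le h₁ h₂

/-- The coordinate holding `1` turns the affine condition on the exponent into a linear form. The
traces involve `t + 1` because `r * g` is bounded only by `H ^ (t + 1)`; the forms supply the
additional factor `θ k`. -/
theorem option_passes_iff (j : Fin M) (g : 𝓞 F) (L : Fin M → ℕ) (r : 𝓞 F) (t : ℕ) (f : ℤ) :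
    (∀ ℓ ∈ (D.option j g).1, 0 < ℓ (D.vec L r t f)) ↔
      D.h ≤ L j ∧ ∀ k, k ≠ 0 →
        (d + 1) * Algebra.trace ℤ (𝓞 F) (1 * D.θ k ^ (t + 1))
          < Algebra.trace ℤ (𝓞 F) (r * g * D.θ k ^ (t + 1)) ∧
        Algebra.trace ℤ (𝓞 F) (r * g * D.θ k ^ (t + 1))
          < D.bound * Algebra.trace ℤ (𝓞 F) (1 * D.θ k ^ (t + 1)) := by
  have e₁ : ∀ k, g * D.θ k * (r * D.θ k ^ t) = r * g * D.θ k ^ (t + 1) := fun k => by ring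
  have e₂ : ∀ k, D.θ k * D.θ k ^ t = 1 * D.θ k ^ (t + 1) := fun k => by ring
  simp only [option, List.mem_cons, List.mem_append, List.mem_map, Finset.mem_toList,
    Finset.mem_erase, Finset.mem_univ, and_true, forall_eq, or_imp, forall_and,
    forall_exists_index, and_imp, forall_apply_eq_imp_iff₂]
  simp only [geForm, lowForm, highForm, vec, LinearMap.coe_mk, AddHom.coe_mk, scalars_expIdx,
    scalars_oneIdx, e₁, e₂, sub_pos]
  refine and_congr ?_ Iff.rfl
  rw [mul_one]
  omega

/-- While an exponent is large, one more factor can be treated; otherwise, the reduction ends. -/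
theorem step_loopOptions [IsTotallyReal F] {L : Fin M → ℕ} {r : 𝓞 F} {t : ℕ}
    (hr : D.Reduced r t) :
    (∃ j g, D.h ≤ L j ∧ IsTotallyPositive σ g ∧ Ideal.span {g} = p j ^ D.h ∧
      D.Reduced (r * g) (t + 1) ∧
      step D.loopOptions (D.vec L r t 1) =
        D.vec (Function.update L j (L j - D.h)) (r * g) (t + 1) 1) ∨
    ((∀ j, L j < D.h) ∧ step D.loopOptions (D.vec L r t 1) = D.vec L r t 0) := by
  have hd1 : (1 : ℝ) ≤ d := by exact_mod_cast NeZero.one_le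
  have hH0 : 0 ≤ D.H := by linarith [D.one_le_H]
  have hle : ∀ j, ∀ g ∈ D.cand j, ∀ l, σ l ((r * g : 𝓞 F) : F) ≤ D.H ^ (t + 1) := by
    intro j g hg l
    simp only [map_mul]
    rw [pow_succ]
    exact mul_le_mul (hr.2.1 l) (D.cand_le j g hg l) (D.cand_pos j g hg l).le (pow_nonneg hH0 t)
  have hone : ∀ k, σ k (D.θ k : F) ^ (t + 1) ≤
        (Algebra.trace ℤ (𝓞 F) (1 * D.θ k ^ (t + 1)) : ℤ) ∧
      (Algebra.trace ℤ (𝓞 F) (1 * D.θ k ^ (t + 1)) : ℤ) ≤ (1 + d) * σ k (D.θ k : F) ^ (t + 1) := by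
    intro k
    simpa using trace_mul_pow_bounds hH0 (D.θ_pos k) (D.θ_dom k) (isTotallyPositive_one σ)
      (n := t + 1) (fun l => by simpa using one_le_pow₀ D.one_le_H)
  have hpos : ∀ k, 0 < σ k (D.θ k : F) ^ (t + 1) := fun k => pow_pos (D.θ_pos k k) _
  have hmul : ∀ j, ∀ g ∈ D.cand j, ∀ k, _ := fun j g hg k =>
    trace_mul_pow_bounds hH0 (D.θ_pos k) (D.θ_dom k) (hr.1.mul (D.cand_pos j g hg))
      (n := t + 1) (hle j g hg)
  by_cases hex : ∃ o ∈ D.options, ∀ ℓ ∈ o.1, 0 < ℓ (D.vec L r t 1)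
  · left
    obtain ⟨o, ho, hpass, hstep⟩ := step_of_exists hex [([], finish F d M)]
    obtain ⟨j, -, ho⟩ := List.mem_flatMap.mp ho
    obtain ⟨g, hg, rfl⟩ := List.mem_map.mp ho
    rw [Finset.mem_toList] at hg
    obtain ⟨hL, htr⟩ := (D.option_passes_iff j g L r t 1).mp hpass
    refine ⟨j, g, hL, D.cand_pos j g hg, D.cand_span j g hg,
      ⟨hr.1.mul (D.cand_pos j g hg), hle j g hg, fun k hk => ?_⟩,
      hstep.trans (D.advance_vec hL g r t 1)⟩
    obtain ⟨h₁, h₂⟩ := hone k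
    obtain ⟨h₃, h₄⟩ := hmul j g hg k
    obtain ⟨h₅, h₆⟩ := htr k hk
    have h₅' : ((d + 1 : ℝ)) * (Algebra.trace ℤ (𝓞 F) (1 * D.θ k ^ (t + 1)) : ℤ)
        < (Algebra.trace ℤ (𝓞 F) (r * g * D.θ k ^ (t + 1)) : ℤ) := by exact_mod_cast h₅
    have h₆' : ((Algebra.trace ℤ (𝓞 F) (r * g * D.θ k ^ (t + 1)) : ℤ) : ℝ)
        < D.bound * (Algebra.trace ℤ (𝓞 F) (1 * D.θ k ^ (t + 1)) : ℤ) := by exact_mod_cast h₆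
    constructor
    -- The test threshold `d + 1` offsets the trace error `d`, which leaves the lower bound `1`.
    · have : (d + 1 : ℝ) * σ k (D.θ k : F) ^ (t + 1)
          < (σ k ((r * g : 𝓞 F) : F) + d) * σ k (D.θ k : F) ^ (t + 1) := by
        refine (mul_le_mul_of_nonneg_left h₁ (by positivity)).trans_lt (h₅'.trans_le h₄)
      have := lt_of_mul_lt_mul_right this (hpos k).le
      linarith
    · refine le_of_mul_le_mul_right ?_ (hpos k)
      calc _ ≤ _ := h₃
        _ ≤ _ := h₆'.le
        _ ≤ D.bound * ((1 + d) * σ k (D.θ k : F) ^ (t + 1)) := by gcongr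
        _ = _ := by ring
  · right
    have hnot : ∀ o ∈ D.options, ¬ ∀ ℓ ∈ o.1, 0 < ℓ (D.vec L r t 1) := by
      intro o ho hpass
      exact hex ⟨o, ho, hpass⟩
    refine ⟨fun j => ?_, ?_⟩
    · by_contra hL
      -- If an exponent were still at least `h`, the candidate adapted to the current `r` would pass
      -- its tests.
      obtain ⟨g, hg, hgx⟩ := D.exists_cand j (fun k => σ k (r : F)) hr.2.2
      refine hnot (D.option j g) ?_ ((D.option_passes_iff j g L r t 1).mpr
        ⟨not_lt.mp hL, fun k hk => ?_⟩)
      · exact List.mem_flatMap.mpr ⟨j, List.mem_finRange j,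
          List.mem_map.mpr ⟨g, Finset.mem_toList.mpr hg, rfl⟩⟩
      · obtain ⟨h₁, h₂⟩ := hone k
        obtain ⟨h₃, h₄⟩ := hmul j g hg k
        obtain ⟨h₅, h₆⟩ := hgx k hk
        have hrg : σ k ((r * g : 𝓞 F) : F) = σ k (r : F) * σ k (g : F) := by simp only [map_mul]
        rw [hrg] at h₃ h₄
        constructor
        -- The trace of `θ k ^ (t + 1)` may be `1 + d` times its main term, so passing a test with
        -- threshold `d + 1` requires more than `(d + 1) ^ 2`; hence the constant in `exists_cand`.
        · have : (d + 1 : ℝ) * (Algebra.trace ℤ (𝓞 F) (1 * D.θ k ^ (t + 1)) : ℤ)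
              < (Algebra.trace ℤ (𝓞 F) (r * g * D.θ k ^ (t + 1)) : ℤ) := by
            calc _ ≤ (d + 1 : ℝ) * ((1 + d) * σ k (D.θ k : F) ^ (t + 1)) := by gcongr
              _ = (d + 1 : ℝ) ^ 2 * σ k (D.θ k : F) ^ (t + 1) := by ring
              _ < σ k (r : F) * σ k (g : F) * σ k (D.θ k : F) ^ (t + 1) :=
                mul_lt_mul_of_pos_right (by linarith) (hpos k)
              _ ≤ _ := h₃
          exact_mod_cast this
        · have : ((Algebra.trace ℤ (𝓞 F) (r * g * D.θ k ^ (t + 1)) : ℤ) : ℝ)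
              < D.bound * (Algebra.trace ℤ (𝓞 F) (1 * D.θ k ^ (t + 1)) : ℤ) := by
            calc _ ≤ _ := h₄
              _ < D.bound * σ k (D.θ k : F) ^ (t + 1) := mul_lt_mul_of_pos_right h₆ (hpos k)
              _ ≤ _ := by gcongr
          exact_mod_cast this
    -- The fallback has no conditions, so it fires and ends the loop.
    · rw [loopOptions, step_of_forall_not hnot]
      simp only [step, List.not_mem_nil, false_imp_iff, implies_true, if_true]
      exact D.finish_vec L r t 1

end ReductionData

end Reduction

/-! ### Termination, output and size estimates. -/

section Reduction

open NumberField BitMachine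

variable {F : Type*} [Field F] [NumberField F] {d : ℕ} [NeZero d] {σ : Fin d ≃ (F →+* ℝ)}
  {M : ℕ} {p : Fin M → Ideal (𝓞 F)} (D : ReductionData σ p)

namespace ReductionData

/-- The reduction ends after linearly many steps with small exponents. -/
theorem iterate_loopOptions [IsTotallyReal F] (n : ℕ) {L : Fin M → ℕ} {r : 𝓞 F} {t : ℕ}
    (hn : ∑ j, L j ≤ n) (hr : D.Reduced r t) :
    ∃ N ≤ n + 1, ∃ (L' : Fin M → ℕ) (r' : 𝓞 F) (t' : ℕ),
      (∀ k < N, 0 < ((step D.loopOptions)^[k] (D.vec L r t 1)).1 (flagIdx M d)) ∧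
      (step D.loopOptions)^[N] (D.vec L r t 1) = D.vec L' r' t' 0 ∧
      (∀ j, L' j < D.h) ∧ D.Reduced r' t' ∧
      Ideal.span {r'} * ∏ j, p j ^ L' j = Ideal.span {r} * ∏ j, p j ^ L j := by
  induction n generalizing L r t with
  | zero =>
    rcases D.step_loopOptions (L := L) hr with ⟨j, g, hL, -⟩ | ⟨hL, hstep⟩
    · have h₁ : L j ≤ ∑ j, L j := Finset.single_le_sum (fun _ _ => Nat.zero_le _)
        (Finset.mem_univ j)
      have := D.h_pos
      omega
    · exact ⟨1, le_rfl, L, r, t, fun k hk => by simp [Nat.lt_one_iff.mp hk, vec], hstep, hL, hr, rfl⟩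
  | succ n ih =>
    rcases D.step_loopOptions (L := L) hr with ⟨j, g, hL, hg, hgp, hr', hstep⟩ | ⟨hL, hstep⟩
    · have hsum : ∑ i, Function.update L j (L j - D.h) i + D.h = ∑ i, L i := by
        rw [← Finset.add_sum_erase _ _ (Finset.mem_univ j),
          ← Finset.add_sum_erase _ L (Finset.mem_univ j), Function.update_self,
          Finset.sum_congr rfl fun i hi => Function.update_of_ne (Finset.ne_of_mem_erase hi) _ _]
        omega
      have hprod : p j ^ D.h * ∏ i, p i ^ Function.update L j (L j - D.h) i = ∏ i, p i ^ L i := by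
        rw [← Finset.mul_prod_erase _ _ (Finset.mem_univ j),
          ← Finset.mul_prod_erase _ (fun i => p i ^ L i) (Finset.mem_univ j), Function.update_self,
          ← mul_assoc, ← pow_add, Nat.add_sub_cancel' hL]
        congr 1
        exact Finset.prod_congr rfl fun i hi => by
          rw [Function.update_of_ne (Finset.ne_of_mem_erase hi)]
      have := D.h_pos
      obtain ⟨N, hN, L', r', t', h₁, h₂, h₃, h₄, h₅⟩ :=
        ih (L := Function.update L j (L j - D.h)) (by omega) hr'
      refine ⟨N + 1, by omega, L', r', t', fun k hk => ?_, ?_, h₃, h₄, ?_⟩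
      · cases k with
        | zero => simp [vec]
        | succ k =>
          rw [Function.iterate_succ_apply, hstep]
          exact h₁ k (by omega)
      · rw [Function.iterate_succ_apply, hstep, h₂]
      · rw [h₅, ← Ideal.span_singleton_mul_span_singleton, hgp, mul_assoc, hprod]
    · exact ⟨1, by omega, L, r, t, fun k hk => by simp [Nat.lt_one_iff.mp hk, vec], hstep, hL, hr,
        rfl⟩

/-- The flag `e` is stored as output, together with the coordinates of the product of the generator
with `β`. -/
noncomputable def outputMap (M : ℕ) (b : Module.Basis (Fin d) ℤ (𝓞 F)) (e : ℤ) (β : 𝓞 F) :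
    Vec F M d →ₗ[ℤ] Vec F M d where
  toFun v := (fun i => if (i : ℕ) = 0 then e * v.1 (oneIdx M d)
    else if h : (i : ℕ) - 1 < d then b.repr (β * v.2.1) ⟨i - 1, h⟩ else 0, 0)
  map_add' v w := by
    refine Prod.ext (funext fun i => ?_) (by simp)
    simp only [Prod.fst_add, Prod.snd_add, Pi.add_apply, mul_add, map_add, Finsupp.add_apply]
    split_ifs <;> simp
  map_smul' c v := by
    refine Prod.ext (funext fun i => ?_) (by simp)
    simp only [Prod.smul_fst, Prod.smul_snd, Pi.smul_apply, RingHom.id_apply, mul_smul_comm,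
      map_smul, Finsupp.smul_apply]
    split_ifs <;> simp

/-- The output for all the possible small exponents. -/
noncomputable def outputOptions (b : Module.Basis (Fin d) ℤ (𝓞 F)) (e : (Fin M → Fin D.h) → ℤ)
    (β : (Fin M → Fin D.h) → 𝓞 F) :
    List (List (Vec F M d →ₗ[ℤ] ℤ) × (Vec F M d →ₗ[ℤ] Vec F M d)) :=
  (Finset.univ : Finset (Fin M → Fin D.h)).toList.map fun s =>
    ((List.finRange M).flatMap fun j => [geForm F d j (s j : ℕ), leForm F d j (s j : ℕ)],
      outputMap M b (e s) (β s))

/-- The two forms for each `j` pin the exponent to `s j`, so exactly one entry of the table passes.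
-/
theorem step_outputOptions (b : Module.Basis (Fin d) ℤ (𝓞 F)) (e : (Fin M → Fin D.h) → ℤ)
    (β : (Fin M → Fin D.h) → 𝓞 F) (s : Fin M → Fin D.h) (r : 𝓞 F) (t : ℕ) (f : ℤ) :
    step (D.outputOptions b e β) (D.vec (fun j => s j) r t f) =
      outputMap M b (e s) (β s) (D.vec (fun j => s j) r t f) := by
  have hpass : ∀ s' : Fin M → Fin D.h,
      (∀ ℓ ∈ (List.finRange M).flatMap fun j =>
        [geForm F d j (s' j : ℕ), leForm F d j (s' j : ℕ)], 0 < ℓ (D.vec (fun j => s j) r t f)) ↔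
      s' = s := by
    intro s'
    simp only [List.mem_flatMap, List.mem_finRange, true_and, List.mem_cons, List.not_mem_nil,
      or_false, forall_exists_index, funext_iff, Fin.ext_iff]
    rw [forall_comm]
    refine forall_congr' fun j => ?_
    simp only [forall_eq_or_imp, forall_eq]
    simp only [geForm, leForm, vec, LinearMap.coe_mk, AddHom.coe_mk, scalars_expIdx,
      scalars_oneIdx]
    omega
  obtain ⟨o, ho, hpo, hstep⟩ := step_of_exists (l := D.outputOptions b e β)
    (v := D.vec (fun j => s j) r t f)
    ⟨_, List.mem_map.mpr ⟨s, Finset.mem_toList.mpr (Finset.mem_univ s), rfl⟩, (hpass s).mpr rfl⟩ []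
  obtain ⟨s', -, rfl⟩ := List.mem_map.mp ho
  obtain rfl := (hpass s').mp hpo
  rwa [List.append_nil] at hstep

omit [NumberField F] in
theorem outputMap_zero (b : Module.Basis (Fin d) ℤ (𝓞 F)) (e : ℤ) (β : 𝓞 F) (L : Fin M → ℕ)
    (r : 𝓞 F) (t : ℕ) (f : ℤ) :
    (outputMap M b e β (D.vec L r t f)).1 ⟨0, by omega⟩ = e := by
  simp [outputMap, vec]

omit [NumberField F] in
theorem outputElement_eq (b : Module.Basis (Fin d) ℤ (𝓞 F)) (e : ℤ) (β : 𝓞 F) (L : Fin M → ℕ)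
    (r : 𝓞 F) (t : ℕ) (f : ℤ) (s : State)
    (hs : ∀ i : Fin (M + d + 3), s i = (outputMap M b e β (D.vec L r t f)).1 i) :
    outputElement b s = β * r := by
  rw [outputElement, ← b.sum_repr (β * r)]
  refine Finset.sum_congr rfl fun i _ => ?_
  have := hs ⟨i + 1, by omega⟩
  simp only at this
  rw [this]
  simp [outputMap, vec]

end ReductionData

/-- An element of the right norm which is in the windows at all embeddings but the first is in the
windows. -/
theorem inWindows_of_bounds [IsTotallyReal F] {Rmin : Fin d → ℝ} (hRmin : ∀ k, 0 < Rmin k) {C : ℝ}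
    (hC : 1 ≤ C) {r : 𝓞 F} (hr : IsTotallyPositive σ r)
    (hk : ∀ k, k ≠ 0 → Rmin k ^ 2 ≤ σ k (r : F) ∧ σ k (r : F) ≤ C * Rmin k ^ 2) {ε : ℝ}
    (hε : 0 < ε) {c₀ : ℝ}
    (hc₀ : c₀ = Real.log (16 * Rmin 0 ^ 2 * (C ^ (d - 1) * ∏ k ∈ Finset.univ.erase 0, Rmin k ^ 2)))
    (hlog : Real.log (Ideal.absNorm (Ideal.span {r})) - 4 * Real.log (1 / ε)
      ∈ Set.Icc c₀ (c₀ + 1)) :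
    InWindows σ Rmin
      (fun k => if k = 0 then Rmin 0 * √(C ^ (d - 1) * Real.exp 1) else √C * Rmin k) ε r := by
  set Q := ∏ k ∈ Finset.univ.erase (0 : Fin d), Rmin k ^ 2 with hQ
  have hQ0 : 0 < Q := Finset.prod_pos fun k _ => pow_pos (hRmin k) 2
  set c := C ^ (d - 1) with hc
  have hc1 : 1 ≤ c := one_le_pow₀ hC
  have hc0 : 0 < c := by linarith
  set S := ∏ k ∈ Finset.univ.erase (0 : Fin d), σ k (r : F) with hS
  have hS1 : Q ≤ S := Finset.prod_le_prod (fun k _ => (pow_pos (hRmin k) 2).le)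
    fun k hk' => (hk k (Finset.ne_of_mem_erase hk')).1
  have hS2 : S ≤ c * Q := by
    calc S ≤ ∏ k ∈ Finset.univ.erase (0 : Fin d), (C * Rmin k ^ 2) :=
          Finset.prod_le_prod (fun k _ => (hr k).le)
            fun k hk' => (hk k (Finset.ne_of_mem_erase hk')).2
      _ = c * Q := by
          rw [Finset.prod_mul_distrib, Finset.prod_const, Finset.card_erase_of_mem
            (Finset.mem_univ _), Finset.card_univ, Fintype.card_fin]
  have hN : (Ideal.absNorm (Ideal.span {r}) : ℝ) = σ 0 (r : F) * S := by
    rw [absNorm_eq_prod σ hr, Finset.mul_prod_erase _ (fun k => σ k (r : F)) (Finset.mem_univ 0)]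
  have hS0 : 0 < S := hQ0.trans_le hS1
  have hx0 : 0 < σ 0 (r : F) := hr 0
  have hR0 := hRmin 0
  have hE : Real.log (Ideal.absNorm (Ideal.span {r})) - 4 * Real.log (1 / ε)
      = Real.log (σ 0 (r : F) * S * ε ^ 4) := by
    rw [hN, Real.log_mul (by positivity) (by positivity) (y := ε ^ 4), Real.log_pow, one_div,
      Real.log_inv]
    push_cast
    ring
  rw [hE, hc₀] at hlog
  obtain ⟨h₁, h₂⟩ := hlog
  rw [Real.log_le_log_iff (by positivity) (by positivity)] at h₁
  rw [← Real.log_exp 1, ← Real.log_mul (by positivity) (by positivity), Real.log_le_log_iff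
    (by positivity) (by positivity)] at h₂
  -- The norm is `σ 0 r * S`, where `S` lies between `Q` and `c * Q`. The constant `c₀` contains the
  -- factor `c`, so the lower bound survives the largest `S`; the upper bound uses the smallest,
  -- losing `c` and the `exp 1` from the length of the interval.
  have h₃ : 16 * Rmin 0 ^ 2 ≤ σ 0 (r : F) * ε ^ 4 := by
    refine le_of_mul_le_mul_right ?_ (mul_pos hc0 hQ0)
    calc _ ≤ _ := h₁
      _ = σ 0 (r : F) * ε ^ 4 * S := by ring
      _ ≤ _ := by gcongr
  have h₄ : σ 0 (r : F) * ε ^ 4 ≤ 16 * Rmin 0 ^ 2 * (c * Real.exp 1) := by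
    refine le_of_mul_le_mul_right ?_ hQ0
    calc σ 0 (r : F) * ε ^ 4 * Q ≤ σ 0 (r : F) * ε ^ 4 * S := by gcongr
      _ = σ 0 (r : F) * S * ε ^ 4 := by ring
      _ ≤ _ := h₂
      _ = _ := by ring
  have hsq : (√(σ 0 (r : F)) * ε ^ 2 / 4) ^ 2 = σ 0 (r : F) * ε ^ 4 / 16 := by
    rw [div_pow, mul_pow, Real.sq_sqrt hx0.le]
    ring
  refine ⟨⟨?_, ?_⟩, fun k hk0 => ⟨?_, ?_⟩⟩
  · rw [← pow_le_pow_iff_left₀ hR0.le (by positivity) two_ne_zero, hsq]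
    linarith
  · dsimp only
    rw [if_pos rfl, ← pow_le_pow_iff_left₀ (by positivity) (by positivity) two_ne_zero, hsq,
      mul_pow, Real.sq_sqrt (by positivity)]
    linarith
  · exact Real.le_sqrt_of_sq_le (hk k hk0).1
  · dsimp only
    rw [if_neg hk0, ← Real.sqrt_sq (hRmin k).le, ← Real.sqrt_mul (by linarith)]
    exact Real.sqrt_le_sqrt (hk k hk0).2

theorem absNorm_two_le {I : Ideal (𝓞 F)} (hI : I.IsPrime) (hI0 : I ≠ ⊥) :
    2 ≤ Ideal.absNorm I := by
  have h₀ : Ideal.absNorm I ≠ 0 := by rwa [Ne, Ideal.absNorm_eq_zero_iff]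
  have h₁ : Ideal.absNorm I ≠ 1 := by rw [Ne, Ideal.absNorm_eq_one_iff]; exact hI.ne_top
  omega

theorem sum_log_absNorm (hp0 : ∀ j, p j ≠ ⊥) (L : Fin M → ℕ) :
    ∑ j, (L j : ℝ) * Real.log (Ideal.absNorm (p j) : ℝ)
      = Real.log (Ideal.absNorm (∏ j, p j ^ L j)) := by
  rw [map_prod, Nat.cast_prod, Real.log_prod]
  · exact Finset.sum_congr rfl fun j _ => by rw [map_pow, Nat.cast_pow, Real.log_pow]
  · intro j _
    rw [map_pow, Nat.cast_pow]
    exact pow_ne_zero _ (by rw [Nat.cast_ne_zero, Ne, Ideal.absNorm_eq_zero_iff]; exact hp0 j)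

/-- This bounds the number of reduction steps by the logarithm of the norm, hence linearly in `log
(1 / ε)`. -/
theorem sum_mul_log_two_le (hp : ∀ j, (p j).IsPrime) (hp0 : ∀ j, p j ≠ ⊥) (L : Fin M → ℕ) :
    ((∑ j, L j : ℕ) : ℝ) * Real.log 2
      ≤ ∑ j, (L j : ℝ) * Real.log (Ideal.absNorm (p j) : ℝ) := by
  rw [Nat.cast_sum, Finset.sum_mul]
  refine Finset.sum_le_sum fun j _ => ?_
  have : (2 : ℝ) ≤ Ideal.absNorm (p j) := by exact_mod_cast absNorm_two_le (hp j) (hp0 j)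
  gcongr

/-- So crude a bound suffices, since the exponents themselves, not just their lengths, are at most
linear in `log (1 / ε)`. -/
theorem bits_natCast_le (n : ℕ) : bits n ≤ n := by
  simp only [bits, Int.natAbs_natCast]
  exact Nat.size_le.mpr Nat.lt_two_pow_self

end Reduction

/-! ### Assembly of the algorithm. -/

theorem mainTheorem3
    (F : Type*) [Field F] [NumberField F] [NumberField.IsTotallyReal F]
    (d : ℕ) [NeZero d] (σ : Fin d ≃ (F →+* ℝ))
    (M : ℕ) (p : Fin M → Ideal (𝓞 F)) (hp : ∀ j, (p j).IsPrime) (hp0 : ∀ j, p j ≠ ⊥)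
    (Rmin : Fin d → ℝ) (hRmin : ∀ k, 0 < Rmin k) :
    ∃ (Cmin Cmax : ℝ) (Rmax : Fin d → ℝ), Cmin < Cmax ∧ (∀ k, Rmin k ≤ Rmax k) ∧
      ∀ b : Module.Basis (Fin d) ℤ (𝓞 F),
      ∃ (alg : BitMachine.Prog) (time : Polynomial ℝ),
        ∀ (L : Fin M → ℕ) (ε : ℝ), 0 < ε → ε < 1 →
          (∑ j, (L j : ℝ) * Real.log (Ideal.absNorm (p j) : ℝ)) - 4 * Real.log (1 / ε)
            ∈ Set.Icc Cmin Cmax →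
          ∀ φ : ℕ → ℤ, BitMachine.Represents φ ε →
            ∃ (s : BitMachine.State) (t : ℕ),
              BitMachine.Exec φ alg (BitMachine.inputState L) s t ∧
              (t : ℝ) ≤ time.eval (Real.log (1 / ε)) ∧
              (¬ HasTotallyPositiveGenerator σ (∏ j, p j ^ L j) → s 0 = 0) ∧
              (HasTotallyPositiveGenerator σ (∏ j, p j ^ L j) →
                s 0 = 1 ∧
                IsTotallyPositive σ (outputElement b s) ∧
                Ideal.span {outputElement b s} = ∏ j, p j ^ L j ∧
                InWindows σ Rmin Rmax ε (outputElement b s)) := by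
  classical
  obtain ⟨D⟩ := nonempty_reductionData σ p hp0
  obtain ⟨K, hK, hunit⟩ := exists_unit_window σ
  have hβ : ∀ s : Fin M → Fin D.h, ∃ β : 𝓞 F,
      HasTotallyPositiveGenerator σ (∏ j, p j ^ (s j : ℕ)) →
      IsTotallyPositive σ β ∧ Ideal.span {β} = ∏ j, p j ^ (s j : ℕ) ∧
        ∀ k, k ≠ 0 → Rmin k ^ 2 ≤ σ k (β : F) ∧ σ k (β : F) ≤ K * Rmin k ^ 2 := by
    intro s
    by_cases hs : HasTotallyPositiveGenerator σ (∏ j, p j ^ (s j : ℕ))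
    · obtain ⟨α, hα, hαs⟩ := hs
      obtain ⟨u, hu, hux⟩ := hunit (fun k => σ k (α : F) / Rmin k ^ 2)
        fun k => div_pos (hα k) (pow_pos (hRmin k) 2)
      refine ⟨α * (u : 𝓞 F), fun _ => ⟨hα.mul hu, ?_, fun k hk => ?_⟩⟩
      · rw [Ideal.span_singleton_mul_right_unit u.isUnit, hαs]
      · have := hux k hk
        have hR := pow_pos (hRmin k) 2
        rw [div_mul_eq_mul_div, le_div_iff₀ hR, div_le_iff₀ hR, one_mul] at this
        simpa only [map_mul] using this
    · exact ⟨0, fun h => absurd h hs⟩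
  choose β hβ using hβ
  set e : (Fin M → Fin D.h) → ℤ := fun s =>
    if HasTotallyPositiveGenerator σ (∏ j, p j ^ (s j : ℕ)) then 1 else 0 with he
  -- For `k ≠ 0` the reduced `r` has coordinates between `1` and `(d + 1) * bound`, and `β` between
  -- `Rmin k ^ 2` and `K * Rmin k ^ 2`; `C` is the ratio allowed for the product.
  set C : ℝ := (d + 1) * D.bound * K with hC
  have hb1 : (1 : ℝ) ≤ D.bound := by exact_mod_cast D.one_le_bound
  have hC1 : 1 ≤ C := by
    have h₁ : (1 : ℝ) ≤ (d + 1) * D.bound := one_le_mul_of_one_le_of_one_le (by simp) hb1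
    exact one_le_mul_of_one_le_of_one_le h₁ hK
  set c₀ : ℝ := Real.log (16 * Rmin 0 ^ 2 *
    (C ^ (d - 1) * ∏ k ∈ Finset.univ.erase 0, Rmin k ^ 2)) with hc₀
  refine ⟨c₀, c₀ + 1,
    fun k => if k = 0 then Rmin 0 * √(C ^ (d - 1) * Real.exp 1) else √C * Rmin k,
    by linarith, fun k => ?_, fun b => ?_⟩
  · dsimp only
    split_ifs with hk
    · subst hk
      refine le_mul_of_one_le_right (hRmin 0).le (Real.one_le_sqrt.mpr ?_)
      exact one_le_mul_of_one_le_of_one_le (one_le_pow₀ hC1) (Real.one_le_exp zero_le_one)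
    · exact le_mul_of_one_le_left (hRmin k).le (Real.one_le_sqrt.mpr hC1)
  -- The hardwired start is `r = 1`, `t = 0`, flag `1`; the zero exponents are placeholders for the
  -- input.
  obtain ⟨alg, c, halg⟩ := BitMachine.exists_prog_of_options (M := M) (n₀ := M + d + 3) (by omega)
    (D.vec 0 1 0 1) (flagIdx M d) D.loopOptions (D.outputOptions b e β)
  have hl2 : 0 < Real.log 2 := Real.log_pos one_lt_two
  -- The inner linear polynomial bounds the sum `T` of the exponents; since `N ≤ T + 1`, the cubed
  -- quantity `N + T + 1` is at most `2 * T + 2`.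
  refine ⟨alg, Polynomial.C (c : ℝ) * (Polynomial.C 2 * (Polynomial.C (4 / Real.log 2) *
    Polynomial.X + Polynomial.C ((c₀ + 1) / Real.log 2)) + Polynomial.C 2) ^ 3,
    fun L ε hε hε1 hL φ _ => ?_⟩
  set T := ∑ j, L j with hT
  obtain ⟨N, hN, L', r, t', hpos, hend, hL', hr, hspan⟩ :=
    D.iterate_loopOptions T (L := L) le_rfl D.reduced_one
  obtain ⟨t, ht, s, hexec, hs⟩ := halg φ L (D.vec L 1 0 1) N T
    (fun i => by
      simp only [ReductionData.vec, scalars]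
      split_ifs <;> rfl) rfl
    (fun j => (bits_natCast_le _).trans
      (Finset.single_le_sum (f := L) (fun _ _ => Nat.zero_le _) (Finset.mem_univ j)))
    hpos (by rw [hend]; simp [ReductionData.vec])
  set s' : Fin M → Fin D.h := fun j => ⟨L' j, hL' j⟩ with hs'
  have hLs : L' = fun j => (s' j : ℕ) := rfl
  rw [hend, hLs, D.step_outputOptions] at hs
  have hs0 : s 0 = e s' := by
    rw [← D.outputMap_zero b (e s') (β s') (fun j => s' j) r t' 0, ← hs ⟨0, by omega⟩]
  have hout : outputElement b s = β s' * r := D.outputElement_eq b _ _ _ _ _ _ _ hs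
  rw [Ideal.span_singleton_one, Ideal.one_eq_top.symm, one_mul] at hspan
  have hr0 : r ≠ 0 := by
    rintro rfl
    have := hr.1 0
    simp at this
  have hiff : HasTotallyPositiveGenerator σ (∏ j, p j ^ L j) ↔
      HasTotallyPositiveGenerator σ (∏ j, p j ^ (s' j : ℕ)) := by
    rw [← hspan, hasTotallyPositiveGenerator_mul_iff σ hr.1 hr0]
  refine ⟨s, t, hexec, ?_, fun hno => ?_, fun hyes => ?_⟩
  · have h₁ : (T : ℝ) ≤ 4 / Real.log 2 * Real.log (1 / ε) + (c₀ + 1) / Real.log 2 := by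
      rw [div_mul_eq_mul_div, ← add_div, le_div_iff₀ hl2]
      have := sum_mul_log_two_le hp hp0 L
      have := hL.2
      linarith
    have h₂ : (t : ℝ) ≤ c * ((N : ℝ) + T + 1) ^ 3 := by exact_mod_cast ht
    have h₃ : (N : ℝ) ≤ T + 1 := by exact_mod_cast hN
    simp only [Polynomial.eval_mul, Polynomial.eval_C, Polynomial.eval_pow, Polynomial.eval_add,
      Polynomial.eval_X]
    refine h₂.trans ?_
    exact mul_le_mul_of_nonneg_left (pow_le_pow_left₀ (by positivity) (by linarith) 3)
      (by positivity)
  · rw [hs0, he]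
    exact if_neg (mt hiff.mpr hno)
  · obtain ⟨h₁, h₂, h₃⟩ := hβ s' (hiff.mp hyes)
    have hpos' : IsTotallyPositive σ (β s' * r) := h₁.mul hr.1
    have hgen : Ideal.span {β s' * r} = ∏ j, p j ^ L j := by
      rw [← Ideal.span_singleton_mul_span_singleton, h₂, mul_comm, ← hspan]
    rw [hout, hs0]
    refine ⟨if_pos (hiff.mp hyes), hpos', hgen,
      inWindows_of_bounds hRmin hC1 hpos' (fun k hk => ?_) hε hc₀ ?_⟩
    · obtain ⟨h₄, h₅⟩ := h₃ k hk
      obtain ⟨h₆, h₇⟩ := hr.2.2 k hk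
      have hR := pow_pos (hRmin k) 2
      simp only [map_mul]
      constructor
      · exact h₄.trans (le_mul_of_one_le_right (h₁ k).le h₆)
      · calc _ ≤ K * Rmin k ^ 2 * ((d + 1) * D.bound) := by
              gcongr
          _ = _ := by rw [hC]; ring
    · rw [hgen, ← sum_log_absNorm hp0]
      exact hL
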